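/- Let $0<q<1$ and $[s]=(q^{-s}-q^{s})/(q^{-1}-q)$. Let $\mathcal A(SU_q(2))$ be the unital $*$-algebra generated by $a,c$ with relations $$ac=qca,\quad ac^*=qc^*a,\quad cc^*=c^*c,\quad a^*a+c^*c=aa^*+q^2cc^*=1,$$ and let $C(SU_q(2))$ be its universal $C^*$-completion. For $u\in U(1)$ let $\alpha_u$ be the $*$-automorphism of either algebra with $\alpha_u(a)=ua$, $\alpha_u(c)=uc$, and let $\mathcal A(\mathbb{CP}^1_q)\subset\mathcal A(SU_q(2))$ and $C(\mathbb{CP}^1_q)\subset C(SU_q(2))$ be the subalgebras of $U(1)$-invariant elements. Let $K^{\pm1},E,F\in\mathcal U_q(su(2))$ act on $\mathcal A(SU_q(2))$ by $K\triangleright(xy)=(K\triangleright x)(K\triangleright y)$, $X\triangleright (xy)=(X\triangleright x)(K\triangleright y)+(K^{-1}\triangleright x)(X\triangleright y)$ for $X=E,F$, $X\triangleright 1=0$, and $$K^{\pm1}\triangleright a=q^{\mp1/2}a,\quad K^{\pm1}\triangleright c=q^{\mp1/2}c,\quad K^{\pm1}\triangleright a^*=q^{\pm1/2}a^*,\quad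 K^{\pm1}\triangleright c^*=q^{\pm1/2}c^*,$$ $$F\triangleright a=F\triangleright c=0,\quad F\triangleright a^*=c,\quad F\triangleright c^*=-q^{-1}a,\qquad E\triangleright a=-qc^*,\quad E\triangleright c=a^*,\quad E\triangleright a^*=E\triangleright c^*=0 .$$ Let $t^l_{mn}$ ($2l\in\mathbb N$; $m,n=-l,\dots,l$) be the matrix elements of the irreducible corepresentations, let $h$ be the Haar state of $C(SU_q(2))$ ($h(1)=1$ and $h(t^l_{mn})=0$ for $l>0$), let $L^2(SU_q(2))$ be its GNS Hilbert space with GNS map $\eta$, with orthonormal basis $|lmn\rangle=q^m[2l+1]^{1/2}\eta(t^l_{mn})$, and let $$L^2(\mathbb{CP}^1_q)=L^2(SU_q(2))^{U(1)}=\overline{\mathrm{Span}}\{|l m 0\rangle : l\in\mathbb N,\ -l\le m\le l\}.$$ Let $\sigma(F)|lmn\rangle=\sqrt{[l-n+1][l+n]}\,|l,m,n-1\rangle$, with domain $\{\psi\in L^2(SU_q(2)):\sigma(F)\psi\in L^2(SU_q(2))\}$, where $\sigma(F)\psi$ is understood as a formal expansion in the basis. On $\mathcal A(\mathbb{CP}^1_q)$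 put $\bar\partial f=(X_-\triangleright f)\,\omega_-$ with $X_-=q^{-1/2}FK$, where $\omega_-$ is one of the three free generators of the left module of one-forms of the three-dimensional left-covariant calculus on $SU_q(2)$. On $C(SU_q(2))$ let $\mathrm{Dom}(\bar\partial)=\{f:\|F\triangleright f\|<\infty\}$, i.e. the set of those $f$ for which there is $g=F\triangleright f\in C(SU_q(2))$ with $\eta(g)=\sigma(F)\eta(f)$; an element $f\in\mathrm{Dom}(\bar\partial)\cap C(\mathbb{CP}^1_q)$ is holomorphic if $F\triangleright f=0$. Then: 1. The kernel of $\sigma(F)$ restricted to $L^2(\mathbb{CP}^1_q)$ is $\mathbb C$, i.e. it is the one-dimensional space $\mathbb C\,\eta(1)$, where $\eta(1)=|000\rangle\neq0$. 2. There are no non-constant holomorphic polynomial functions on $\mathbb{CP}^1_q$: the algebra $\ker(\bar\partial:\mathcal A(\mathbb{CP}^1_q)\to\Omega^{(0,1)}(\mathbb{CP}^1_q))$ equals $\mathbb C\cdot1$ and is isomorphic to $\mathbb C$. 3. There are no non-constant holomorphic functions in $\mathrm{Dom}(\bar\partial)\cap C(\mathbb{CP}^1_q)$: the set of holomorphic elements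 equals $\mathbb C\cdot1$. Consequently this set is a subalgebra of $C(SU_q(2))$, and $\mathcal O(\mathbb{CP}^1_q)\cong\mathbb C$ as an algebra. -/

import Mathlib

noncomputable section

namespace QuantumCP

open scoped ENNReal ComplexOrder

/-- The deformation parameter `q`, a real number with `0 < q < 1`. -/
abbrev Par : Type := Set.Ioo (0 : ℝ) 1

/-- The number `q`, as a complex number. -/
def qc (q : Par) : ℂ := ((q : ℝ) : ℂ)

/-- The number `q^x` (`x` real), as a complex number. -/
def qpow (q : Par) (x : ℝ) : ℂ := (((q : ℝ) ^ x : ℝ) : ℂ)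

/-- The `q`-number `[s] = (q^{-s} - q^s) / (q^{-1} - q)`. -/
def qnum (q : Par) (s : ℝ) : ℝ :=
  ((q : ℝ) ^ (-s) - (q : ℝ) ^ s) / ((q : ℝ)⁻¹ - (q : ℝ))

/-! ### The coordinate algebra of `SU_q(2)` -/

/-- The four generators `a, a*, c, c*`. -/
inductive Gen : Type
  | a | as | c | cs

open FreeAlgebra in
/-- The defining relations of `A(SU_q(2))`, together with their adjoints. -/
inductive Rel (q : Par) : FreeAlgebra ℂ Gen → FreeAlgebra ℂ Gen → Prop
  | ac : Rel q (ι ℂ .a * ι ℂ .c) (qc q • (ι ℂ .c * ι ℂ .a))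
  | acs : Rel q (ι ℂ .a * ι ℂ .cs) (qc q • (ι ℂ .cs * ι ℂ .a))
  | csas : Rel q (ι ℂ .cs * ι ℂ .as) (qc q • (ι ℂ .as * ι ℂ .cs))
  | cas : Rel q (ι ℂ .c * ι ℂ .as) (qc q • (ι ℂ .as * ι ℂ .c))
  | ccs : Rel q (ι ℂ .c * ι ℂ .cs) (ι ℂ .cs * ι ℂ .c)
  | asa : Rel q (ι ℂ .as * ι ℂ .a + ι ℂ .cs * ι ℂ .c) 1
  | aas : Rel q (ι ℂ .a * ι ℂ .as + (qc q ^ 2) • (ι ℂ .c * ι ℂ .cs)) 1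

/-- The coordinate algebra `A(SU_q(2))`. Its `*`-structure is defined below. -/
def ASU (q : Par) : Type := RingQuot (Rel q)

instance (q : Par) : Ring (ASU q) := inferInstanceAs (Ring (RingQuot (Rel q)))
instance (q : Par) : Algebra ℂ (ASU q) := inferInstanceAs (Algebra ℂ (RingQuot (Rel q)))

namespace ASU

variable {q : Par}

/-- The quotient map from the free algebra. -/
def mk (q : Par) : FreeAlgebra ℂ Gen →ₐ[ℂ] ASU q := RingQuot.mkAlgHom ℂ (Rel q)

/-- The class of a generator. -/
def gen (q : Par) (g : Gen) : ASU q := mk q (FreeAlgebra.ι ℂ g)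

theorem mk_surjective : Function.Surjective (mk q) := RingQuot.mkAlgHom_surjective ℂ (Rel q)

theorem mk_rel {x y : FreeAlgebra ℂ Gen} (h : Rel q x y) : mk q x = mk q y :=
  RingQuot.mkAlgHom_rel ℂ h

/-- Images of the generators in some algebra satisfy the relations. -/
structure Sat (q : Par) {B : Type*} [Ring B] [Algebra ℂ B] (f : Gen → B) : Prop where
  ac : f .a * f .c = qc q • (f .c * f .a)
  acs : f .a * f .cs = qc q • (f .cs * f .a)
  csas : f .cs * f .as = qc q • (f .as * f .cs)
  cas : f .c * f .as = qc q • (f .as * f .c)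
  ccs : f .c * f .cs = f .cs * f .c
  asa : f .as * f .a + f .cs * f .c = 1
  aas : f .a * f .as + (qc q ^ 2) • (f .c * f .cs) = 1

theorem sat_gen : Sat q (gen q) where
  ac := by simpa [gen] using mk_rel (Rel.ac (q := q))
  acs := by simpa [gen] using mk_rel (Rel.acs (q := q))
  csas := by simpa [gen] using mk_rel (Rel.csas (q := q))
  cas := by simpa [gen] using mk_rel (Rel.cas (q := q))
  ccs := by simpa [gen] using mk_rel (Rel.ccs (q := q))
  asa := by simpa [gen] using mk_rel (Rel.asa (q := q))
  aas := by simpa [gen] using mk_rel (Rel.aas (q := q))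

/-- The algebra homomorphism out of `A(SU_q(2))` given by its values on the generators. -/
def lift {B : Type*} [Ring B] [Algebra ℂ B] (f : Gen → B) (hf : Sat q f) : ASU q →ₐ[ℂ] B :=
  RingQuot.liftAlgHom ℂ ⟨FreeAlgebra.lift ℂ f, by
    rintro x y (_ | _ | _ | _ | _ | _ | _)
    · simpa using hf.ac
    · simpa using hf.acs
    · simpa using hf.csas
    · simpa using hf.cas
    · simpa using hf.ccs
    · simpa using hf.asa
    · simpa using hf.aas⟩

@[simp] theorem lift_gen {B : Type*} [Ring B] [Algebra ℂ B] (f : Gen → B) (hf : Sat q f)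
    (g : Gen) : lift f hf (gen q g) = f g := by
  refine (RingQuot.liftAlgHom_mkAlgHom_apply ℂ _ _ _).trans ?_
  simp

@[elab_as_elim]
theorem induction {p : ASU q → Prop} (algebraMap : ∀ z : ℂ, p (algebraMap ℂ _ z))
    (gen : ∀ g, p (gen q g)) (mul : ∀ x y, p x → p y → p (x * y))
    (add : ∀ x y, p x → p y → p (x + y)) (x : ASU q) : p x := by
  obtain ⟨y, rfl⟩ := mk_surjective x
  refine FreeAlgebra.induction (motive := fun y => p (mk q y)) ℂ Gen ?_ ?_ ?_ ?_ y
  · intro z; simpa using algebraMap z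
  · intro g; exact gen g
  · intro x y hx hy; simpa using mul _ _ hx hy
  · intro x y hx hy; simpa using add _ _ hx hy

/-- The opposite algebra with conjugated scalar multiplication. -/
def ConjOp (q : Par) : Type := (ASU q)ᵐᵒᵖ

instance : Ring (ConjOp q) := inferInstanceAs (Ring (ASU q)ᵐᵒᵖ)

instance : Algebra ℂ (ConjOp q) :=
  Algebra.compHom (A := (ASU q)ᵐᵒᵖ) (starRingEnd ℂ)

/-- The opposite of an element. -/
def toConj (x : ASU q) : ConjOp q := MulOpposite.op x

theorem toConj_mul (x y : ASU q) : toConj x * toConj y = toConj (y * x) := rfl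

theorem toConj_add (x y : ASU q) : toConj x + toConj y = toConj (x + y) := rfl

theorem toConj_smul (z : ℂ) (x : ASU q) :
    z • toConj x = toConj ((starRingEnd ℂ z) • x) := rfl

/-- The involution on the generators. -/
def starGen : Gen → Gen
  | .a => .as
  | .as => .a
  | .c => .cs
  | .cs => .c

theorem sat_star : Sat q (fun g => toConj (gen q (starGen g))) := by
  have h := sat_gen (q := q)
  have hq : starRingEnd ℂ (qc q) = qc q := Complex.conj_ofReal _
  constructor <;> simp only [starGen, toConj_mul, toConj_add, toConj_smul, hq, map_pow]
  · exact congrArg toConj h.csas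
  · exact congrArg toConj h.cas
  · exact congrArg toConj h.ac
  · exact congrArg toConj h.acs
  · exact congrArg toConj h.ccs
  · exact congrArg toConj h.asa
  · exact congrArg toConj h.aas

/-- The conjugate-linear antimultiplicative involution, as a homomorphism into `ConjOp`. -/
def starHom (q : Par) : ASU q →ₐ[ℂ] ConjOp q := lift _ sat_star

/-- The involution of `A(SU_q(2))`: the conjugate-linear antiautomorphism which exchanges
`a` with `a*` and `c` with `c*`. -/
instance : Star (ASU q) := ⟨fun x => MulOpposite.unop (starHom q x : (ASU q)ᵐᵒᵖ)⟩

theorem star_gen (g : Gen) : star (gen q g) = gen q (starGen g) := by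
  change MulOpposite.unop (starHom q (gen q g) : (ASU q)ᵐᵒᵖ) = _
  rw [starHom, lift_gen]; rfl

theorem star_algebraMap (z : ℂ) :
    star (algebraMap ℂ (ASU q) z) = algebraMap ℂ (ASU q) (starRingEnd ℂ z) := by
  change MulOpposite.unop (starHom q (algebraMap ℂ (ASU q) z) : (ASU q)ᵐᵒᵖ) = _
  rw [AlgHom.commutes]; rfl

protected theorem star_mul (x y : ASU q) : star (x * y) = star y * star x := by
  change MulOpposite.unop (starHom q (x * y) : (ASU q)ᵐᵒᵖ) = _
  rw [map_mul]; rfl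

protected theorem star_add (x y : ASU q) : star (x + y) = star x + star y := by
  change MulOpposite.unop (starHom q (x + y) : (ASU q)ᵐᵒᵖ) = _
  rw [map_add]; rfl

instance : StarRing (ASU q) where
  star_involutive x := by
    induction x using induction with
    | algebraMap z => simp [star_algebraMap]
    | gen g => cases g <;> simp [star_gen, starGen]
    | mul x y hx hy => rw [ASU.star_mul, ASU.star_mul, hx, hy]
    | add x y hx hy => rw [ASU.star_add, ASU.star_add, hx, hy]
  star_mul := ASU.star_mul
  star_add := ASU.star_add

instance : StarModule ℂ (ASU q) where
  star_smul z x := by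
    rw [Algebra.smul_def, ASU.star_mul, star_algebraMap, Algebra.smul_def, Algebra.commutes]
    rfl

end ASU

/-- The generator `a`. -/
def ga (q : Par) : ASU q := ASU.gen q .a
/-- The generator `c`. -/
def gc (q : Par) : ASU q := ASU.gen q .c

/-! ### The action of `U(1)` and the coordinate algebra of the quantum projective line -/

open ASU in
/-- The values `a ↦ u a`, `c ↦ u c`, `a* ↦ u⁻¹ a*`, `c* ↦ u⁻¹ c*`. -/
def alphaGen (q : Par) (u : Circle) : Gen → ASU q
  | .a => (u : ℂ) • gen q .a
  | .c => (u : ℂ) • gen q .c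
  | .as => (starRingEnd ℂ (u : ℂ)) • gen q .as
  | .cs => (starRingEnd ℂ (u : ℂ)) • gen q .cs

theorem sat_alpha (q : Par) (u : Circle) : ASU.Sat q (alphaGen q u) := by
  have h := ASU.sat_gen (q := q)
  have h1 : (u : ℂ) * starRingEnd ℂ (u : ℂ) = 1 := by simp [Complex.mul_conj]
  have h2 : starRingEnd ℂ (u : ℂ) * (u : ℂ) = 1 := by rw [mul_comm]; exact h1
  constructor <;> simp only [alphaGen, smul_mul_smul_comm, h1, h2, one_smul]
  · rw [h.ac, smul_smul, smul_smul, mul_comm]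
  · rw [h.acs]
  · rw [h.csas, smul_smul, smul_smul, mul_comm]
  · rw [h.cas]
  · rw [h.ccs]
  · rw [h.asa]
  · rw [h.aas]

/-- The action `α_u` of `u ∈ U(1)` by `*`-automorphisms of `A(SU_q(2))`. -/
def alpha (q : Par) (u : Circle) : ASU q →⋆ₐ[ℂ] ASU q where
  __ := ASU.lift (alphaGen q u) (sat_alpha q u)
  map_star' x := by
    change ASU.lift (alphaGen q u) (sat_alpha q u) (star x) =
      star (ASU.lift (alphaGen q u) (sat_alpha q u) x)
    induction x using ASU.induction with
    | algebraMap z => rw [ASU.star_algebraMap, AlgHom.commutes, AlgHom.commutes,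
        ASU.star_algebraMap]
    | gen g => cases g <;> simp [ASU.star_gen, ASU.starGen, alphaGen]
    | mul x y hx hy => simp [hx, hy]
    | add x y hx hy => simp [hx, hy]

/-- The coordinate algebra `A(CP^1_q)`: the `U(1)`-invariant elements of `A(SU_q(2))`. -/
def ACP (q : Par) : Subalgebra ℂ (ASU q) where
  carrier := {x | ∀ u : Circle, alpha q u x = x}
  mul_mem' hx hy u := by rw [map_mul, hx u, hy u]
  add_mem' hx hy u := by rw [map_add, hx u, hy u]
  algebraMap_mem' z u := AlgHomClass.commutes _ z

/-! ### The left action of `U_q(su(2))` on `A(SU_q(2))`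

The action is a module algebra structure, so the coproducts `Δ(K) = K ⊗ K` and
`Δ(X) = X ⊗ K + K⁻¹ ⊗ X` for `X = E, F` say that `K` acts by an algebra automorphism and that
`X ▷ (xy) = (X ▷ x) (K ▷ y) + (K⁻¹ ▷ x) (X ▷ y)`. Equivalently,
`x ↦ !![K⁻¹ ▷ x, X ▷ x; 0, K ▷ x]` is an algebra homomorphism, and this is how the actions of
`E` and `F` are obtained from their values on the generators. -/

/-- `K^{±1}` on the generators (`e = ±1`):
`K ▷ a = q^{-1/2} a`, `K ▷ c = q^{-1/2} c`, `K ▷ a* = q^{1/2} a*`, `K ▷ c* = q^{1/2} c*`. -/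
def KGen (q : Par) (e : ℝ) : Gen → ASU q
  | .a => qpow q (-e / 2) • ASU.gen q .a
  | .c => qpow q (-e / 2) • ASU.gen q .c
  | .as => qpow q (e / 2) • ASU.gen q .as
  | .cs => qpow q (e / 2) • ASU.gen q .cs

/-- `F` on the generators: `F ▷ a = 0`, `F ▷ c = 0`, `F ▷ a* = c`, `F ▷ c* = -q⁻¹ a`. -/
def FGen (q : Par) : Gen → ASU q
  | .a => 0
  | .c => 0
  | .as => ASU.gen q .c
  | .cs => (-(qc q)⁻¹) • ASU.gen q .a

/-- `E` on the generators: `E ▷ a = -q c*`, `E ▷ c = a*`, `E ▷ a* = 0`, `E ▷ c* = 0`. -/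
def EGen (q : Par) : Gen → ASU q
  | .a => (-qc q) • ASU.gen q .cs
  | .c => ASU.gen q .as
  | .as => 0
  | .cs => 0

theorem qpow_add (q : Par) (x y : ℝ) : qpow q x * qpow q y = qpow q (x + y) := by
  rw [qpow, qpow, qpow, ← Complex.ofReal_mul, ← Real.rpow_add q.2.1]

theorem qpow_zero (q : Par) : qpow q 0 = 1 := by simp [qpow]

theorem qpow_one (q : Par) : qpow q 1 = qc q := by simp [qpow, qc]

theorem sat_K (q : Par) (e : ℝ) : ASU.Sat q (KGen q e) := by
  have h := ASU.sat_gen (q := q)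
  have h1 : qpow q (-e / 2) * qpow q (e / 2) = 1 := by
    rw [qpow_add, ← qpow_zero q]; ring_nf
  have h2 : qpow q (e / 2) * qpow q (-e / 2) = 1 := by rw [mul_comm]; exact h1
  constructor <;> simp only [KGen, smul_mul_smul_comm, h1, h2, one_smul]
  · rw [h.ac, smul_smul, smul_smul, mul_comm]
  · rw [h.acs]
  · rw [h.csas, smul_smul, smul_smul, mul_comm]
  · rw [h.cas]
  · rw [h.ccs]
  · rw [h.asa]
  · rw [h.aas]

/-- The action `x ↦ K ▷ x`. -/
def actK (q : Par) : ASU q →ₐ[ℂ] ASU q := ASU.lift (KGen q 1) (sat_K q 1)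

/-- The matrices `!![K⁻¹ ▷ g, X ▷ g; 0, K ▷ g]` for the generators `g`. -/
def twGen (q : Par) (X : Gen → ASU q) (g : Gen) : Matrix (Fin 2) (Fin 2) (ASU q) :=
  !![KGen q (-1) g, X g; 0, KGen q 1 g]

/-- What `X` has to satisfy on products of generators. -/
theorem sat_tw (q : Par) (X : Gen → ASU q)
    (ac : KGen q (-1) .a * X .c + X .a * KGen q 1 .c =
      qc q • (KGen q (-1) .c * X .a + X .c * KGen q 1 .a))
    (acs : KGen q (-1) .a * X .cs + X .a * KGen q 1 .cs =
      qc q • (KGen q (-1) .cs * X .a + X .cs * KGen q 1 .a))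
    (csas : KGen q (-1) .cs * X .as + X .cs * KGen q 1 .as =
      qc q • (KGen q (-1) .as * X .cs + X .as * KGen q 1 .cs))
    (cas : KGen q (-1) .c * X .as + X .c * KGen q 1 .as =
      qc q • (KGen q (-1) .as * X .c + X .as * KGen q 1 .c))
    (ccs : KGen q (-1) .c * X .cs + X .c * KGen q 1 .cs =
      KGen q (-1) .cs * X .c + X .cs * KGen q 1 .c)
    (asa : (KGen q (-1) .as * X .a + X .as * KGen q 1 .a) +
      (KGen q (-1) .cs * X .c + X .cs * KGen q 1 .c) = 0)
    (aas : (KGen q (-1) .a * X .as + X .a * KGen q 1 .as) +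
      (qc q ^ 2) • (KGen q (-1) .c * X .cs + X .c * KGen q 1 .cs) = 0) :
    ASU.Sat q (twGen q X) := by
  have hp := sat_K q 1
  have hm := sat_K q (-1)
  have one : (1 : Matrix (Fin 2) (Fin 2) (ASU q)) = !![1, 0; 0, 1] := Matrix.one_fin_two
  constructor <;>
    simp only [twGen, Matrix.mul_fin_two, Matrix.smul_of, one, mul_zero, zero_mul, add_zero,
      zero_add, Matrix.smul_cons, smul_zero, Matrix.smul_empty, Matrix.of_add_of,
      Matrix.add_cons, Matrix.head_cons, Matrix.tail_cons, Matrix.empty_add_empty]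
  · rw [hm.ac, hp.ac, ac]
  · rw [hm.acs, hp.acs, acs]
  · rw [hm.csas, hp.csas, csas]
  · rw [hm.cas, hp.cas, cas]
  · rw [hm.ccs, hp.ccs, ccs]
  · rw [hm.asa, hp.asa, asa]
  · rw [hm.aas, hp.aas, aas]

theorem exists_sqrt (q : Par) : ∃ s : ℂ, s ≠ 0 ∧ qc q = s ^ 2 ∧ qpow q (-(-1) / 2) = s ∧
    qpow q (1 / 2) = s ∧ qpow q (-1 / 2) = s⁻¹ := by
  have hs : qpow q (1 / 2) * qpow q (-1 / 2) = 1 := by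
    rw [qpow_add, ← qpow_zero q]; norm_num
  refine ⟨qpow q (1 / 2), left_ne_zero_of_mul_eq_one hs, ?_, ?_, rfl, eq_inv_of_mul_eq_one_right hs⟩
  · rw [pow_two, qpow_add, ← qpow_one]; norm_num
  · norm_num

theorem sat_F (q : Par) : ASU.Sat q (twGen q (FGen q)) := by
  obtain ⟨s, hs, hq, h1, h2, h3⟩ := exists_sqrt q
  have h := ASU.sat_gen (q := q)
  have hac := h.ac
  have hccs := h.ccs
  have haas := eq_sub_of_add_eq h.aas
  have hasa := eq_sub_of_add_eq h.asa
  rw [hq] at hac haas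
  apply sat_tw <;>
    simp only [KGen, FGen, h1, h2, h3, hq, mul_zero, zero_mul, add_zero, zero_add, smul_zero,
      smul_mul_assoc, mul_smul_comm, smul_smul, hac, hccs, haas, hasa]
  all_goals match_scalars
  all_goals field_simp
  all_goals ring

theorem sat_E (q : Par) : ASU.Sat q (twGen q (EGen q)) := by
  obtain ⟨s, hs, hq, h1, h2, h3⟩ := exists_sqrt q
  have h := ASU.sat_gen (q := q)
  have hcsas := h.csas
  have hccs := h.ccs
  have haas := eq_sub_of_add_eq h.aas
  have hasa := eq_sub_of_add_eq h.asa
  rw [hq] at hcsas haas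
  apply sat_tw <;>
    simp only [KGen, EGen, h1, h2, h3, hq, mul_zero, zero_mul, add_zero, zero_add, smul_zero,
      smul_mul_assoc, mul_smul_comm, smul_smul, hccs, hcsas, haas, hasa]
  all_goals match_scalars
  all_goals field_simp
  all_goals ring

/-- The linear map `x ↦ X ▷ x` obtained from the twisted Leibniz rule, as the upper right entry
of the algebra homomorphism `x ↦ !![K⁻¹ ▷ x, X ▷ x; 0, K ▷ x]`. -/
def actTw (q : Par) (X : Gen → ASU q) (hX : ASU.Sat q (twGen q X)) : ASU q →ₗ[ℂ] ASU q where
  toFun x := ASU.lift (twGen q X) hX x 0 1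
  map_add' x y := by simp
  map_smul' z x := by simp

/-- The action `x ↦ F ▷ x`. -/
def actF (q : Par) : ASU q →ₗ[ℂ] ASU q := actTw q (FGen q) (sat_F q)

/-- The action `x ↦ E ▷ x`. -/
def actE (q : Par) : ASU q →ₗ[ℂ] ASU q := actTw q (EGen q) (sat_E q)

theorem lift_tw (q : Par) (X : Gen → ASU q) (hX : ASU.Sat q (twGen q X)) (x : ASU q) :
    ASU.lift (twGen q X) hX x 1 0 = 0 ∧ ASU.lift (twGen q X) hX x 1 1 = actK q x ∧
      ASU.lift (twGen q X) hX x 0 0 = ASU.lift (KGen q (-1)) (sat_K q (-1)) x := by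
  induction x using ASU.induction with
  | algebraMap z => simp [Matrix.algebraMap_matrix_apply]
  | gen g => simp [twGen, actK]
  | mul x y hx hy =>
    simp only [map_mul, Matrix.mul_apply, Fin.sum_univ_two, hx.1, hx.2.1, hx.2.2, hy.1, hy.2.1,
      hy.2.2]
    simp
  | add x y hx hy => simp [hx, hy]

/-- The twisted Leibniz rule `X ▷ (xy) = (X ▷ x) (K ▷ y) + (K⁻¹ ▷ x) (X ▷ y)`. -/
theorem actTw_mul (q : Par) (X : Gen → ASU q) (hX : ASU.Sat q (twGen q X)) (x y : ASU q) :
    actTw q X hX (x * y) = actTw q X hX x * actK q y +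
      ASU.lift (KGen q (-1)) (sat_K q (-1)) x * actTw q X hX y := by
  have hx := lift_tw q X hX x
  have hy := lift_tw q X hX y
  simp only [actTw, LinearMap.coe_mk, AddHom.coe_mk, map_mul, Matrix.mul_apply,
    Fin.sum_univ_two, hx.2.2, hy.2.1]
  rw [add_comm]

theorem actTw_gen (q : Par) (X : Gen → ASU q) (hX : ASU.Sat q (twGen q X)) (g : Gen) :
    actTw q X hX (ASU.gen q g) = X g := by
  simp [actTw, twGen]

theorem actTw_algebraMap (q : Par) (X : Gen → ASU q) (hX : ASU.Sat q (twGen q X)) (z : ℂ) :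
    actTw q X hX (algebraMap ℂ _ z) = 0 := by
  simp [actTw, Matrix.algebraMap_matrix_apply]

/-- The action of `X_- = q^{-1/2} F K`. -/
def actXminus (q : Par) : ASU q →ₗ[ℂ] ASU q :=
  qpow q (-1 / 2) • (actF q ∘ₗ (actK q).toLinearMap)

/-! ### The operator `∂̄` and holomorphic polynomial functions -/

/-- The one-forms on `SU_q(2)`: the free left module with basis `ω_-, ω_+, ω_z`, labelled by
`0, 1, 2`. -/
abbrev Omega1 (q : Par) : Type := Fin 3 → ASU q

/-- The `(0,1)`-form `x ω_-`. -/
def omegaMinus (q : Par) : ASU q →ₗ[ℂ] Omega1 q := LinearMap.single ℂ (fun _ => ASU q) 0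

/-- The operator `∂̄ f = (X_- ▷ f) ω_-` on `A(CP^1_q)`. -/
def dbar (q : Par) : ACP q →ₗ[ℂ] Omega1 q :=
  omegaMinus q ∘ₗ actXminus q ∘ₗ (ACP q).val.toLinearMap

theorem dbar_eq_zero_iff (q : Par) (f : ACP q) : dbar q f = 0 ↔ actF q (actK q f) = 0 := by
  have hs : qpow q (-1 / 2) ≠ 0 := by
    obtain ⟨s, hs, -, -, -, h3⟩ := exists_sqrt q
    rw [h3]; exact inv_ne_zero hs
  simp [dbar, omegaMinus, actXminus, hs]

/-- The algebra of holomorphic polynomial functions: the kernel of `∂̄` on `A(CP^1_q)`. -/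
def holoPoly (q : Par) : Subalgebra ℂ (ACP q) where
  carrier := {f | dbar q f = 0}
  mul_mem' {f g} hf hg := by
    change dbar q f = 0 at hf
    change dbar q g = 0 at hg
    change dbar q (f * g) = 0
    rw [dbar_eq_zero_iff] at hf hg ⊢
    rw [MulMemClass.coe_mul, map_mul, actF, actTw_mul]
    rw [actF] at hf hg
    rw [hf, hg, mul_zero, zero_mul, add_zero]
  add_mem' {f g} hf hg := by
    change dbar q f = 0 at hf
    change dbar q g = 0 at hg
    change dbar q (f + g) = 0
    rw [map_add, hf, hg, add_zero]
  algebraMap_mem' z := by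
    change dbar q (algebraMap ℂ _ z) = 0
    rw [dbar_eq_zero_iff]
    change actF q (actK q (algebraMap ℂ (ASU q) z)) = 0
    rw [AlgHom.commutes, actF, actTw_algebraMap]

/-! ### The universal `C*`-algebra `C(SU_q(2))` -/

/-- A representation of `A(SU_q(2))`: a unital `*`-homomorphism into a nonzero unital
`C*`-algebra. -/
structure Rep (q : Par) : Type 1 where
  B : Type
  [cstar : CStarAlgebra B]
  [nontriv : Nontrivial B]
  ρ : ASU q →⋆ₐ[ℂ] B

attribute [instance] Rep.cstar Rep.nontriv

/-- The `ℓ^∞`-product of the targets of all representations. -/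
abbrev ProdRep (q : Par) : Type 1 := lp (fun r : Rep q => r.B) ∞

instance (q : Par) : CStarAlgebra (ProdRep q) where

theorem Rep.norm_gen_le {q : Par} (r : Rep q) (g : Gen) : ‖r.ρ (ASU.gen q g)‖ ≤ 1 := by
  let _ := CStarAlgebra.spectralOrder r.B
  let _ := CStarAlgebra.spectralOrderedRing r.B
  have hs := ASU.sat_gen (q := q)
  have key : ∀ x y : r.B, star x * x + star y * y = 1 → ‖x‖ ≤ 1 ∧ ‖y‖ ≤ 1 := by
    have key' : ∀ x y : r.B, star x * x + star y * y = 1 → ‖x‖ ≤ 1 := by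
      intro x y hxy
      have h1 : star x * x ≤ 1 := by
        rw [← hxy]; exact le_add_of_nonneg_right (star_mul_self_nonneg y)
      have h2 := CStarAlgebra.norm_le_norm_of_nonneg_of_le (star_mul_self_nonneg x) h1
      rw [CStarRing.norm_star_mul_self, CStarRing.norm_one] at h2
      nlinarith [norm_nonneg x]
    exact fun x y hxy => ⟨key' x y hxy, key' y x (by rw [add_comm]; exact hxy)⟩
  have hac := key (r.ρ (ASU.gen q .a)) (r.ρ (ASU.gen q .c)) (by
    rw [← map_star, ← map_star, ← map_mul, ← map_mul, ← map_add, ASU.star_gen, ASU.star_gen,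
      ASU.starGen, ASU.starGen, hs.asa, map_one])
  have hst : ∀ g, ‖r.ρ (ASU.gen q (ASU.starGen g))‖ = ‖r.ρ (ASU.gen q g)‖ := by
    intro g
    rw [← ASU.star_gen, map_star, norm_star]
  cases g with
  | a => exact hac.1
  | as => exact (hst .a).trans_le hac.1
  | c => exact hac.2
  | cs => exact (hst .c).trans_le hac.2

theorem Rep.bounded {q : Par} (x : ASU q) : ∃ M : ℝ, ∀ r : Rep q, ‖r.ρ x‖ ≤ M := by
  induction x using ASU.induction with
  | algebraMap z =>
    refine ⟨‖z‖, fun r => ?_⟩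
    rw [AlgHomClass.commutes, norm_algebraMap']
  | gen g => exact ⟨1, fun r => r.norm_gen_le g⟩
  | mul x y hx hy =>
    obtain ⟨M, hM⟩ := hx
    obtain ⟨N, hN⟩ := hy
    refine ⟨M * N, fun r => ?_⟩
    rw [map_mul]
    exact (norm_mul_le _ _).trans
      (mul_le_mul (hM r) (hN r) (norm_nonneg _) ((norm_nonneg _).trans (hM r)))
  | add x y hx hy =>
    obtain ⟨M, hM⟩ := hx
    obtain ⟨N, hN⟩ := hy
    refine ⟨M + N, fun r => ?_⟩
    rw [map_add]
    exact (norm_add_le _ _).trans (add_le_add (hM r) (hN r))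

/-- The universal representation `x ↦ (ρ(x))_ρ`. -/
def univRep (q : Par) : ASU q →⋆ₐ[ℂ] ProdRep q where
  toFun x := ⟨fun r => r.ρ x, by
    obtain ⟨M, hM⟩ := Rep.bounded x
    exact memℓp_infty ⟨M, by rintro _ ⟨r, rfl⟩; exact hM r⟩⟩
  map_one' := by ext r; simp
  map_mul' x y := by ext r; simp
  map_zero' := by ext r; simp
  map_add' x y := by ext r; simp; rfl
  commutes' z := by ext r; simp [AlgHomClass.commutes]; rfl
  map_star' x := by ext r; simp [map_star]

/-- `C(SU_q(2))` as a `*`-subalgebra of the product: the closure of the image of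
`A(SU_q(2))` under the universal representation. -/
def CSUsub (q : Par) : StarSubalgebra ℂ (ProdRep q) := (univRep q).range.topologicalClosure

/-- The universal `C*`-algebra `C(SU_q(2))`: the completion of `A(SU_q(2))` with respect to the
supremum of the norms `‖ρ(x)‖` over all representations. -/
abbrev CSU (q : Par) : Type 1 := CSUsub q

instance (q : Par) : CStarAlgebra (CSU q) :=
  StarSubalgebra.cstarAlgebra _ (h_closed := StarSubalgebra.isClosed_topologicalClosure _)

instance (q : Par) : PartialOrder (CSU q) := CStarAlgebra.spectralOrder _
instance (q : Par) : StarOrderedRing (CSU q) := CStarAlgebra.spectralOrderedRing _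

/-- The canonical map `A(SU_q(2)) → C(SU_q(2))`. -/
def toCSU (q : Par) : ASU q →⋆ₐ[ℂ] CSU q :=
  (univRep q).codRestrict (CSUsub q) fun x =>
    StarSubalgebra.le_topologicalClosure _ ⟨x, rfl⟩

/-- The representation `ρ ∘ α_u`. -/
def Rep.rotate {q : Par} (u : Circle) (r : Rep q) : Rep q where
  B := r.B
  ρ := r.ρ.comp (alpha q u)

/-- The `*`-endomorphism of the product given by `(x_ρ)_ρ ↦ (x_{ρ ∘ α_u})_ρ`. -/
def alphaProd (q : Par) (u : Circle) : ProdRep q →⋆ₐ[ℂ] ProdRep q where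
  toFun x := ⟨fun r => x (r.rotate u), by
    refine memℓp_infty ⟨‖x‖, ?_⟩
    rintro _ ⟨r, rfl⟩
    exact lp.norm_apply_le_norm ENNReal.top_ne_zero x (r.rotate u)⟩
  map_one' := rfl
  map_mul' x y := rfl
  map_zero' := rfl
  map_add' x y := rfl
  commutes' z := rfl
  map_star' x := rfl

theorem alphaProd_univRep (q : Par) (u : Circle) (x : ASU q) :
    alphaProd q u (univRep q x) = univRep q (alpha q u x) := rfl

theorem alphaProd_mem (q : Par) (u : Circle) (x : ProdRep q) (hx : x ∈ CSUsub q) :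
    alphaProd q u x ∈ CSUsub q := by
  have hc : Continuous (alphaProd q u) := by
    refine AddMonoidHomClass.continuous_of_bound (alphaProd q u) 1 fun x => ?_
    rw [one_mul]
    refine lp.norm_le_of_forall_le (norm_nonneg x) fun r => ?_
    exact lp.norm_apply_le_norm ENNReal.top_ne_zero x (r.rotate u)
  refine map_mem_closure (s := ((univRep q).range : Set (ProdRep q))) hc hx ?_
  rintro _ ⟨y, rfl⟩
  exact ⟨alpha q u y, (alphaProd_univRep q u y).symm⟩

/-- The action of `u ∈ U(1)` on `C(SU_q(2))`, extending `α_u` on `A(SU_q(2))`. -/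
def alphaC (q : Par) (u : Circle) : CSU q →⋆ₐ[ℂ] CSU q :=
  ((alphaProd q u).comp (CSUsub q).subtype).codRestrict (CSUsub q) fun x =>
    alphaProd_mem q u x x.2

theorem alphaC_toCSU (q : Par) (u : Circle) (x : ASU q) :
    alphaC q u (toCSU q x) = toCSU q (alpha q u x) := rfl

/-- The `C*`-algebra `C(CP^1_q)`: the `U(1)`-invariant elements of `C(SU_q(2))`. -/
def CCP (q : Par) : Subalgebra ℂ (CSU q) where
  carrier := {x | ∀ u : Circle, alphaC q u x = x}
  mul_mem' hx hy u := by rw [map_mul, hx u, hy u]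
  add_mem' hx hy u := by rw [map_add, hx u, hy u]
  algebraMap_mem' z u := AlgHomClass.commutes _ z

/-! ### Matrix elements, Haar state, and the Hilbert space `L²(SU_q(2))`

The labels `(l, m, n)` with `2l ∈ ℕ` and `m, n ∈ {-l, ..., l}` are encoded by natural numbers
`d = 2l`, `j = l + m`, `k = l + n` with `j, k ≤ d`. -/

/-- The set of labels `(l, m, n)`. -/
abbrev Lab : Type := Σ d : ℕ, Fin (d + 1) × Fin (d + 1)

/-- The spin `l`. -/
def Lab.l (i : Lab) : ℝ := (i.1 : ℝ) / 2
/-- The label `m`. -/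
def Lab.m (i : Lab) : ℝ := (i.2.1 : ℕ) - (i.1 : ℝ) / 2
/-- The label `n`. -/
def Lab.n (i : Lab) : ℝ := (i.2.2 : ℕ) - (i.1 : ℝ) / 2

/-- The matrix element `t^l_{mn}` of the spin `l` irreducible corepresentation. The lowest column
is `t^l_{m,-l} = q^{-(l-m)(l+m)/2} [2l choose l+m]^{1/2} a^{l-m} c^{l+m}`, where
`[2l choose l+m] = ∏_{s < l+m} [2l-s]/[s+1]`, and the other columns are determined by
`E ▷ t^l_{mn} = ([l-n][l+n+1])^{1/2} t^l_{m,n+1}`. -/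
def matEl (q : Par) (i : Lab) : ASU q :=
  (((∏ s ∈ Finset.range i.2.2, √(qnum q (i.1 - s) * qnum q (s + 1)))⁻¹ : ℝ) : ℂ) •
    (actE q ^ (i.2.2 : ℕ))
      ((qpow q (-((i.l - i.m) * (i.l + i.m)) / 2) *
          ((√(∏ s ∈ Finset.range i.2.1, qnum q (i.1 - s) / qnum q (s + 1)) : ℝ) : ℂ)) •
        (ga q ^ (i.1 - (i.2.1 : ℕ)) * gc q ^ (i.2.1 : ℕ)))

/-- The defining properties of the Haar state: it is a state with `h(1) = 1` and
`h(t^l_{mn}) = 0` for `l > 0`. -/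
def IsHaar (q : Par) (h : CSU q →ₚ[ℂ] ℂ) : Prop :=
  h 1 = 1 ∧ ∀ i : Lab, 0 < i.l → h (toCSU q (matEl q i)) = 0

/-- The Haar state of `C(SU_q(2))`, i.e. the unique positive functional with the property
`IsHaar`. -/
def haar (q : Par) : CSU q →ₚ[ℂ] ℂ := Classical.epsilon (IsHaar q)

/-- The Hilbert space `L²(SU_q(2))` of the GNS representation of the Haar state. -/
abbrev L2 (q : Par) : Type 1 := (haar q).GNS

/-- The GNS map `η : C(SU_q(2)) → L²(SU_q(2))`. -/
def eta (q : Par) : CSU q →ₗ[ℂ] L2 q :=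
  (UniformSpace.Completion.toComplₗᵢ (𝕜 := ℂ) (E := (haar q).PreGNS)).toLinearMap ∘ₗ
    (haar q).toPreGNS.toLinearMap

/-- The orthonormal basis vectors `|lmn⟩ = q^m [2l+1]^{1/2} η(t^l_{mn})`. -/
def ket (q : Par) (i : Lab) : L2 q :=
  (qpow q i.m * ((√(qnum q (2 * i.l + 1)) : ℝ) : ℂ)) • eta q (toCSU q (matEl q i))

/-- The coefficients `⟨lmn|ψ⟩` of a vector `ψ` with respect to this basis. -/
def coeff (q : Par) : L2 q →ₗ[ℂ] (Lab → ℂ) where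
  toFun ψ i := inner ℂ (ket q i) ψ
  map_add' ψ φ := by ext i; exact inner_add_right _ _ _
  map_smul' z ψ := by ext i; exact inner_smul_right _ _ _

/-- The formal expansion `σ(F) ψ`, given by its coefficients. As
`σ(F)|lmn⟩ = ([l-n+1][l+n])^{1/2} |l,m,n-1⟩`, the coefficient of `σ(F) ψ` at `|lmn⟩` is
`([l-n][l+n+1])^{1/2} ⟨l,m,n+1|ψ⟩` if `n < l`, and it is `0` if `n = l`. -/
def sigmaF (q : Par) : L2 q →ₗ[ℂ] (Lab → ℂ) where
  toFun ψ i :=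
    if h : (i.2.2 : ℕ) + 1 < i.1 + 1 then
      ((√(qnum q (i.l - i.n) * qnum q (i.l + i.n + 1)) : ℝ) : ℂ) *
        coeff q ψ ⟨i.1, i.2.1, ⟨i.2.2 + 1, h⟩⟩
    else 0
  map_add' ψ φ := by
    ext i
    simp only [Pi.add_apply]
    split_ifs
    · rw [map_add, Pi.add_apply, mul_add]
    · rw [add_zero]
  map_smul' z ψ := by
    ext i
    simp only [Pi.smul_apply, RingHom.id_apply]
    split_ifs
    · rw [map_smul, Pi.smul_apply, smul_eq_mul, smul_eq_mul, mul_left_comm]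
    · rw [smul_zero]

/-- The domain of `σ(F)`: the vectors `ψ ∈ L²(SU_q(2))` with `σ(F) ψ ∈ L²(SU_q(2))`. -/
def domSigmaF (q : Par) : Submodule ℂ (L2 q) :=
  (LinearMap.range (coeff q)).comap (sigmaF q)

/-- The action of `u ∈ U(1)` on `L²(SU_q(2))`, in coefficients: `ρ(u)|lmn⟩ = u^{-2n} |lmn⟩`,
so that `ρ(u) η(f) = η(α_u(f))`. -/
def rho (q : Par) (u : Circle) : L2 q →ₗ[ℂ] (Lab → ℂ) where
  toFun ψ i := ((u ^ ((i.1 : ℤ) - 2 * (i.2.2 : ℕ)) : Circle) : ℂ) * coeff q ψ i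
  map_add' ψ φ := by ext i; simp [mul_add]
  map_smul' z ψ := by ext i; simp [mul_left_comm]

/-- The Hilbert space `L²(CP^1_q)` of `U(1)`-invariant vectors in `L²(SU_q(2))`. -/
def L2CP (q : Par) : Submodule ℂ (L2 q) :=
  ⨅ u : Circle, LinearMap.eqLocus (rho q u) (coeff q)

/-- The kernel of `σ(F)` restricted to `L²(CP^1_q)`. -/
def kerSigmaF (q : Par) : Submodule ℂ (L2 q) :=
  L2CP q ⊓ domSigmaF q ⊓ LinearMap.ker (sigmaF q)

/-! ### Holomorphic continuous functions -/

/-- `F ▷ f = g` for `f, g ∈ C(SU_q(2))`, where the action of `F` is the one which is compatible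
with `σ(F)` under the GNS map: `σ(F) η(f) = η(g)`. -/
def ActFC (q : Par) (f g : CSU q) : Prop := sigmaF q (eta q f) = coeff q (eta q g)

/-- The domain of `∂̄` in `C(SU_q(2))`: the elements `f` for which `F ▷ f` has a finite norm,
i.e. is an element of `C(SU_q(2))`. -/
def domDbar (q : Par) : Set (CSU q) := {f | ∃ g : CSU q, ActFC q f g}

/-- The holomorphic continuous functions: the elements of `Dom(∂̄) ∩ C(CP^1_q)` in the kernel of
`∂̄ f = q^{-1/2} (F ▷ f) ω_-`. -/
def holoCont (q : Par) : Set (CSU q) := {f | f ∈ domDbar q ∧ f ∈ CCP q ∧ ActFC q f 0}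

end QuantumCP
end

noncomputable section

namespace QuantumCP

open scoped ENNReal ComplexOrder

/-! In the basis |lmn⟩ the operator σ(F) lowers n, with a coefficient that vanishes only at n = -l,
so a vector in its kernel has coefficients only at n = -l. Invariance under U(1) allows only n = 0.
Together these force l = 0, and ℂη(1) remains (`kerSigmaF_eq`). The argument needs the vectors |lmn⟩
to be total, which follows from `span_matEl` and density. Of their orthogonality it needs only
h(t^l_{mn}) = 0 for l > 0.

For continuous f, invariance of h under U(1) places η(f) in L²(CP^1_q) (`eta_mem_L2CP`). Hence η(f)
is a multiple of η(1), and f is constant because η is injective. This injectivity is faithfulness of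
h on the universal C*-algebra (`haar_faithful`), the main analytic input.

Since `haar` is a choice among functionals with `IsHaar`, existence and uniqueness must be supplied.
The representation on ℓ²(ℕ × ℤ) provides h(x) = (1 - q²) ∑ q^{2k} ⟨e_{k,0}, x e_{k,0}⟩. This
functional vanishes on the range of E (`haarSum_actE`), hence on t^l_{mn} for l > 0. Uniqueness is
`span_matEl` plus density. For faithfulness, averaging over a two-torus maps C(SU_q(2)) into the
closed algebra generated by cc*, whose spectrum lies in {0} ∪ {q^{2k}}. There the vector states at
e_{k,0} are evaluation at q^{2k}, so they separate elements, and a positive element with zero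
average is zero.

The polynomial case is deduced from the continuous one. If F ▷ (K ▷ f) = 0, then h(F ▷ y) = 0 and
the twisted Leibniz rule make w = K² ▷ f orthogonal to the range of E, which contains all t^l_{mn}
with n > -l. So w is holomorphic in the continuous sense, hence constant, and so is f. The formula
for σ(F) on η(A(SU_q(2))) is never needed. -/

theorem mul_pow_of_smul_comm {B : Type*} [Ring B] [Algebra ℂ B] {x y : B} {z : ℂ}
    (h : x * y = z • (y * x)) (n : ℕ) : x * y ^ n = z ^ n • (y ^ n * x) := by
  induction n with
  | zero => simp
  | succ n ih =>
    rw [pow_succ, ← mul_assoc, ih, smul_mul_assoc, mul_assoc, h, mul_smul_comm, smul_smul,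
      ← mul_assoc, ← pow_succ]

/-- The generator `a*`. -/
def gas (q : Par) : ASU q := ASU.gen q .as
/-- The generator `c*`. -/
def gcs (q : Par) : ASU q := ASU.gen q .cs

theorem qc_ne_zero (q : Par) : qc q ≠ 0 := by
  simpa [qc] using q.2.1.ne'

/-! ### Commutation relations and normally ordered monomials -/

section relations
variable (q : Par)

theorem c_mul_a : gc q * ga q = (qc q)⁻¹ • (ga q * gc q) := by
  have := (ASU.sat_gen (q := q)).ac
  rw [ga, gc, this, smul_smul, inv_mul_cancel₀ (qc_ne_zero q), one_smul]

theorem cs_mul_a : gcs q * ga q = (qc q)⁻¹ • (ga q * gcs q) := by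
  have := (ASU.sat_gen (q := q)).acs
  rw [ga, gcs, this, smul_smul, inv_mul_cancel₀ (qc_ne_zero q), one_smul]

theorem c_mul_as : gc q * gas q = qc q • (gas q * gc q) := (ASU.sat_gen (q := q)).cas
theorem cs_mul_as : gcs q * gas q = qc q • (gas q * gcs q) := (ASU.sat_gen (q := q)).csas
theorem commute_c_cs : Commute (gc q) (gcs q) := (ASU.sat_gen (q := q)).ccs
theorem as_mul_a : gas q * ga q = 1 - gc q * gcs q := by
  rw [(commute_c_cs q).eq]; exact eq_sub_of_add_eq (ASU.sat_gen (q := q)).asa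
theorem a_mul_as : ga q * gas q = 1 - (qc q ^ 2) • (gc q * gcs q) :=
  eq_sub_of_add_eq (ASU.sat_gen (q := q)).aas

theorem star_gc : star (gc q) = gcs q := ASU.star_gen _
theorem star_gcs : star (gcs q) = gc q := ASU.star_gen _
end relations

/-- The powers of `a` and `a*`: `a^i` for `i ≥ 0`, and `(a*)^{-i}` for `i < 0`. -/
def apow (q : Par) : ℤ → ASU q
  | .ofNat n => ga q ^ n
  | .negSucc n => gas q ^ (n + 1)

/-- The normally ordered monomials `a^i c^m (c*)^n`. -/
def nmon (q : Par) (i : ℤ) (m n : ℕ) : ASU q := apow q i * (gc q ^ m * gcs q ^ n)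

/-- The linear span of the normally ordered monomials. -/
def nspan (q : Par) : Submodule ℂ (ASU q) :=
  Submodule.span ℂ (Set.range fun p : ℤ × ℕ × ℕ => nmon q p.1 p.2.1 p.2.2)

theorem nmon_mem (q : Par) (i : ℤ) (m n : ℕ) : nmon q i m n ∈ nspan q :=
  Submodule.subset_span ⟨(i, m, n), rfl⟩

theorem apow_natCast (q : Par) (n : ℕ) : apow q n = ga q ^ n := rfl
theorem apow_neg_natCast (q : Par) (n : ℕ) : apow q (-(n : ℤ)) = gas q ^ n := by
  cases n with
  | zero => rw [Nat.cast_zero, neg_zero]; exact (pow_zero _).trans (pow_zero _).symm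
  | succ n => rfl

theorem apow_cases {p : ℤ → Prop} (h1 : ∀ n : ℕ, p n) (h2 : ∀ n : ℕ, p (-((n : ℤ) + 1))) (i : ℤ) :
    p i := by
  obtain n | n := i
  · exact h1 n
  · have := h2 n
    rwa [show -((n : ℤ) + 1) = Int.negSucc n by omega] at this

theorem apow_neg_succ (q : Par) (n : ℕ) : apow q (-((n : ℤ) + 1)) = gas q ^ (n + 1) := by
  exact_mod_cast apow_neg_natCast q (n + 1)

theorem c_mul_apow (q : Par) (i : ℤ) : ∃ z : ℂ, gc q * apow q i = z • (apow q i * gc q) := by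
  obtain n | n := i
  · exact ⟨_, mul_pow_of_smul_comm (c_mul_a q) n⟩
  · exact ⟨_, mul_pow_of_smul_comm (c_mul_as q) (n + 1)⟩

theorem cs_mul_apow (q : Par) (i : ℤ) : ∃ z : ℂ, gcs q * apow q i = z • (apow q i * gcs q) := by
  obtain n | n := i
  · exact ⟨_, mul_pow_of_smul_comm (cs_mul_a q) n⟩
  · exact ⟨_, mul_pow_of_smul_comm (cs_mul_as q) (n + 1)⟩

theorem c_mul_nmon (q : Par) (i : ℤ) (m n : ℕ) :
    ∃ z : ℂ, gc q * nmon q i m n = z • nmon q i (m + 1) n := by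
  obtain ⟨z, hz⟩ := c_mul_apow q i
  refine ⟨z, ?_⟩
  rw [nmon, nmon, ← mul_assoc, hz, smul_mul_assoc, mul_assoc, ← mul_assoc (gc q), ← pow_succ']

theorem cs_mul_nmon (q : Par) (i : ℤ) (m n : ℕ) :
    ∃ z : ℂ, gcs q * nmon q i m n = z • nmon q i m (n + 1) := by
  obtain ⟨z, hz⟩ := cs_mul_apow q i
  refine ⟨z, ?_⟩
  rw [nmon, nmon, ← mul_assoc, hz, smul_mul_assoc, mul_assoc, ← mul_assoc (gcs q),
    ((commute_c_cs q).symm.pow_right m).eq, mul_assoc, ← pow_succ']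

theorem mul_mem_nspan_of (q : Par) (x : ASU q) (h : ∀ i m n, x * nmon q i m n ∈ nspan q)
    {y : ASU q} (hy : y ∈ nspan q) : x * y ∈ nspan q := by
  induction hy using Submodule.span_induction with
  | mem y hy => obtain ⟨p, rfl⟩ := hy; exact h _ _ _
  | zero => simp
  | add y z _ _ hy hz => rw [mul_add]; exact add_mem hy hz
  | smul z y _ hy => rw [mul_smul_comm]; exact Submodule.smul_mem _ _ hy

/-- The elements c and c* move past powers of a and a* at the cost of a scalar. When a meets a*, in
either order, the product is 1 minus a multiple of cc*, and the span is already stable under c and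
c*. -/
theorem gen_mul_mem_nspan (q : Par) (g : Gen) {y : ASU q} (hy : y ∈ nspan q) :
    ASU.gen q g * y ∈ nspan q := by
  have hc : ∀ {y : ASU q}, y ∈ nspan q → gc q * y ∈ nspan q := fun hy =>
    mul_mem_nspan_of q _ (fun i m n => by
      obtain ⟨z, hz⟩ := c_mul_nmon q i m n
      rw [hz]; exact Submodule.smul_mem _ _ (nmon_mem q _ _ _)) hy
  have hcs : ∀ {y : ASU q}, y ∈ nspan q → gcs q * y ∈ nspan q := fun hy =>
    mul_mem_nspan_of q _ (fun i m n => by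
      obtain ⟨z, hz⟩ := cs_mul_nmon q i m n
      rw [hz]; exact Submodule.smul_mem _ _ (nmon_mem q _ _ _)) hy
  have hccs : ∀ {y : ASU q} (z : ℂ), y ∈ nspan q → (1 - z • (gc q * gcs q)) * y ∈ nspan q := by
    intro y z hy
    rw [sub_mul, one_mul, smul_mul_assoc, mul_assoc]
    exact sub_mem hy (Submodule.smul_mem _ _ (hc (hcs hy)))
  cases g with
  | c => exact hc hy
  | cs => exact hcs hy
  | a =>
    refine mul_mem_nspan_of q (ga q) (fun i m n => ?_) hy
    induction i using apow_cases with
    | h1 k =>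
      rw [nmon, apow_natCast, ← mul_assoc, ← pow_succ', ← apow_natCast]
      exact nmon_mem q _ _ _
    | h2 k =>
      rw [nmon, apow_neg_succ, pow_succ', mul_assoc (gas q), ← mul_assoc (ga q), a_mul_as,
        ← apow_neg_natCast]
      exact hccs _ (nmon_mem q _ _ _)
  | as =>
    refine mul_mem_nspan_of q (gas q) (fun i m n => ?_) hy
    induction i using apow_cases with
    | h1 k =>
      cases k with
      | zero =>
        have : gas q * nmon q (0 : ℕ) m n = nmon q (-((0 : ℕ) + 1)) m n := by
          rw [nmon, nmon, apow_natCast, apow_neg_succ]; simp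
        rw [this]; exact nmon_mem q _ _ _
      | succ k =>
        rw [nmon, apow_natCast, pow_succ', mul_assoc (ga q), ← mul_assoc (gas q), as_mul_a,
          ← apow_natCast, ← one_smul ℂ (gc q * gcs q)]
        exact hccs _ (nmon_mem q _ _ _)
    | h2 k =>
      rw [nmon, apow_neg_succ, ← mul_assoc, ← pow_succ', ← apow_neg_natCast]
      exact nmon_mem q _ _ _

/-- The span is a left ideal, and it contains 1. -/
theorem nspan_eq_top (q : Par) : nspan q = ⊤ := by
  have key : ∀ x y : ASU q, y ∈ nspan q → x * y ∈ nspan q := by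
    intro x
    induction x using ASU.induction with
    | algebraMap z => intro y hy; rw [← Algebra.smul_def]; exact Submodule.smul_mem _ _ hy
    | gen g => intro y hy; exact gen_mul_mem_nspan q g hy
    | mul x y hx hy => intro w hw; rw [mul_assoc]; exact hx _ (hy _ hw)
    | add x y hx hy => intro w hw; rw [add_mul]; exact add_mem (hx _ hw) (hy _ hw)
  refine eq_top_iff.2 fun x _ => ?_
  have h1 : (1 : ASU q) ∈ nspan q := by
    have : nmon q 0 0 0 = 1 := by
      rw [nmon, show (0 : ℤ) = ((0 : ℕ) : ℤ) from rfl, apow_natCast]; simp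
    rw [← this]; exact nmon_mem q _ _ _
  simpa using key x 1 h1

@[elab_as_elim]
theorem nmon_induction {q : Par} {p : ASU q → Prop} (nmon : ∀ i m n, p (nmon q i m n))
    (zero : p 0) (add : ∀ x y, p x → p y → p (x + y)) (smul : ∀ (z : ℂ) x, p x → p (z • x))
    (x : ASU q) : p x := by
  have hx : x ∈ nspan q := nspan_eq_top q ▸ Submodule.mem_top
  induction hx using Submodule.span_induction with
  | mem x hx => obtain ⟨j, rfl⟩ := hx; exact nmon _ _ _
  | zero => exact zero
  | add x y _ _ hx hy => exact add x y hx hy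
  | smul z x _ hx => exact smul z x hx

/-! ### The action of the torus -/

/-- The values `a ↦ u a`, `c ↦ v c`, `a* ↦ u⁻¹ a*`, `c* ↦ v⁻¹ c*`. -/
def tauGen (q : Par) (g : Circle × Circle) : Gen → ASU q
  | .a => (g.1 : ℂ) • ASU.gen q .a
  | .c => (g.2 : ℂ) • ASU.gen q .c
  | .as => (starRingEnd ℂ (g.1 : ℂ)) • ASU.gen q .as
  | .cs => (starRingEnd ℂ (g.2 : ℂ)) • ASU.gen q .cs

theorem sat_tau (q : Par) (g : Circle × Circle) : ASU.Sat q (tauGen q g) := by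
  have h := ASU.sat_gen (q := q)
  have h1 : ∀ u : Circle, (u : ℂ) * starRingEnd ℂ (u : ℂ) = 1 := by simp [Complex.mul_conj]
  have h2 : ∀ u : Circle, starRingEnd ℂ (u : ℂ) * (u : ℂ) = 1 := fun u => by
    rw [mul_comm]; exact h1 u
  constructor <;> simp only [tauGen, smul_mul_smul_comm, h1, h2, one_smul]
  · rw [h.ac, smul_smul, smul_smul]; ring_nf
  · rw [h.acs, smul_smul, smul_smul]; ring_nf
  · rw [h.csas, smul_smul, smul_smul]; ring_nf
  · rw [h.cas, smul_smul, smul_smul]; ring_nf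
  · rw [h.ccs]
  · rw [h.asa]
  · rw [h.aas]

/-- The action of the torus on `A(SU_q(2))` by `*`-automorphisms. -/
def tau (q : Par) (g : Circle × Circle) : ASU q →⋆ₐ[ℂ] ASU q where
  __ := ASU.lift (tauGen q g) (sat_tau q g)
  map_star' x := by
    change ASU.lift (tauGen q g) (sat_tau q g) (star x) =
      star (ASU.lift (tauGen q g) (sat_tau q g) x)
    induction x using ASU.induction with
    | algebraMap z => rw [ASU.star_algebraMap, AlgHom.commutes, AlgHom.commutes,
        ASU.star_algebraMap]
    | gen g => cases g <;> simp [ASU.star_gen, ASU.starGen, tauGen]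
    | mul x y hx hy => simp [hx, hy]
    | add x y hx hy => simp [hx, hy]

theorem tau_gen (q : Par) (g : Circle × Circle) (j : Gen) :
    tau q g (ASU.gen q j) = tauGen q g j :=
  ASU.lift_gen _ (sat_tau q g) _

theorem alpha_gen (q : Par) (u : Circle) (j : Gen) :
    alpha q u (ASU.gen q j) = alphaGen q u j :=
  ASU.lift_gen _ (sat_alpha q u) _

theorem alpha_eq_tau (q : Par) (u : Circle) : alpha q u = tau q (u, u) := by
  ext x
  induction x using ASU.induction with
  | algebraMap z => rw [AlgHomClass.commutes, AlgHomClass.commutes]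
  | gen g => rw [alpha_gen, tau_gen]; cases g <;> rfl
  | mul x y hx hy => rw [map_mul, map_mul, hx, hy]
  | add x y hx hy => rw [map_add, map_add, hx, hy]

theorem tau_apow (q : Par) (g : Circle × Circle) (i : ℤ) :
    tau q g (apow q i) = ((g.1 ^ i : Circle) : ℂ) • apow q i := by
  induction i using apow_cases with
  | h1 n =>
    rw [apow_natCast, map_pow, ga, tau_gen, tauGen, smul_pow]; simp
  | h2 n =>
    rw [apow_neg_succ, map_pow, gas, tau_gen, tauGen, smul_pow]
    congr 1
    rw [zpow_neg, ← Nat.cast_succ, zpow_natCast, ← inv_pow, Circle.coe_pow,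
      Circle.coe_inv_eq_conj]

/-- Independent phases on a and c detect i and m - n separately, whereas α_u sees only the sum i + m
- n. -/
theorem tau_nmon (q : Par) (g : Circle × Circle) (i : ℤ) (m n : ℕ) :
    tau q g (nmon q i m n) = ((g.1 ^ i * g.2 ^ ((m : ℤ) - n) : Circle) : ℂ) • nmon q i m n := by
  rw [nmon, map_mul, tau_apow, map_mul, map_pow, map_pow, gc, gcs, tau_gen, tau_gen, tauGen,
    tauGen, smul_pow, smul_pow, smul_mul_smul_comm, smul_mul_smul_comm]
  congr 1
  rw [Circle.coe_mul, zpow_sub, Circle.coe_mul, zpow_natCast, zpow_natCast, ← inv_pow,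
    Circle.coe_pow, Circle.coe_pow, Circle.coe_inv_eq_conj]

/-! ### Compatibility of E, F and K with each other, the torus and the involution -/

theorem ASU.hom_ext {q : Par} {B : Type*} [Semiring B] [Algebra ℂ B] {φ ψ : ASU q →ₐ[ℂ] B}
    (h : ∀ g, φ (ASU.gen q g) = ψ (ASU.gen q g)) (x : ASU q) : φ x = ψ x := by
  induction x using ASU.induction with
  | algebraMap z => rw [AlgHom.commutes, AlgHom.commutes]
  | gen g => exact h g
  | mul x y hx hy => rw [map_mul, map_mul, hx, hy]
  | add x y hx hy => rw [map_add, map_add, hx, hy]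

/-- The action `x ↦ K^e ▷ x`. -/
def actKe (q : Par) (e : ℝ) : ASU q →ₐ[ℂ] ASU q := ASU.lift (KGen q e) (sat_K q e)

theorem actKe_gen (q : Par) (e : ℝ) (g : Gen) : actKe q e (ASU.gen q g) = KGen q e g :=
  ASU.lift_gen _ _ _

theorem actKe_neg (q : Par) (e : ℝ) (x : ASU q) : actKe q e (actKe q (-e) x) = x := by
  refine ASU.hom_ext (φ := (actKe q e).comp (actKe q (-e))) (ψ := AlgHom.id ℂ _) (fun g => ?_) x
  have h (x y : ℝ) (h : x + y = 0) (z : ASU q) : qpow q x • qpow q y • z = z := by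
    rw [smul_smul, qpow_add, h, qpow_zero, one_smul]
  cases g <;> simp only [AlgHom.comp_apply, actKe_gen, KGen, map_smul, AlgHom.id_apply] <;>
    exact h _ _ (by ring) _

theorem actE_mul (q : Par) (x y : ASU q) :
    actE q (x * y) = actE q x * actKe q 1 y + actKe q (-1) x * actE q y := actTw_mul q _ _ x y

theorem actF_mul (q : Par) (x y : ASU q) :
    actF q (x * y) = actF q x * actKe q 1 y + actKe q (-1) x * actF q y := actTw_mul q _ _ x y

theorem actE_gen (q : Par) (g : Gen) : actE q (ASU.gen q g) = EGen q g := actTw_gen q _ _ g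
theorem actF_gen (q : Par) (g : Gen) : actF q (ASU.gen q g) = FGen q g := actTw_gen q _ _ g
theorem actE_algebraMap (q : Par) (z : ℂ) : actE q (algebraMap ℂ _ z) = 0 :=
  actTw_algebraMap q _ _ z
theorem actF_algebraMap (q : Par) (z : ℂ) : actF q (algebraMap ℂ _ z) = 0 :=
  actTw_algebraMap q _ _ z
theorem actE_one (q : Par) : actE q 1 = 0 := by
  rw [← map_one (algebraMap ℂ (ASU q)), actE_algebraMap]

theorem actKe_comm (q : Par) (e f : ℝ) (x : ASU q) :
    actKe q e (actKe q f x) = actKe q f (actKe q e x) := by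
  refine ASU.hom_ext (φ := (actKe q e).comp (actKe q f)) (ψ := (actKe q f).comp (actKe q e))
    (fun g => ?_) x
  cases g <;> simp only [AlgHom.comp_apply, actKe_gen, KGen, map_smul] <;> rw [smul_comm]

/-- Consequently K preserves the kernel of every power of E, as the nilpotency estimate
`actE_pow_mul` requires. -/
theorem actE_actKe (q : Par) (e : ℝ) (x : ASU q) :
    actE q (actKe q e x) = qpow q (-e) • actKe q e (actE q x) := by
  induction x using ASU.induction with
  | algebraMap z => simp [actE_algebraMap]
  | gen g =>
    have h : qpow q (-e / 2) = qpow q (-e) * qpow q (e / 2) := by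
      rw [qpow_add]; congr 1; ring
    cases g
    · simp only [actKe_gen, KGen, map_smul, actE_gen, EGen, smul_smul]
      rw [h]; congr 1; ring
    · simp only [actKe_gen, KGen, map_smul, actE_gen, EGen, map_zero, smul_zero]
    · simp only [actKe_gen, KGen, map_smul, actE_gen, EGen, smul_smul]
      rw [h]
    · simp only [actKe_gen, KGen, map_smul, actE_gen, EGen, map_zero, smul_zero]
  | mul x y hx hy =>
    rw [map_mul, actE_mul, actE_mul, hx, hy, map_add, map_mul, map_mul, smul_mul_assoc,
      mul_smul_comm, ← smul_add, actKe_comm q e 1, actKe_comm q e (-1)]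
  | add x y hx hy => simp only [map_add, hx, hy, smul_add]

theorem actKe_tau (q : Par) (e : ℝ) (g : Circle × Circle) (x : ASU q) :
    actKe q e (tau q g x) = tau q g (actKe q e x) := by
  refine ASU.hom_ext (φ := (actKe q e).comp (tau q g : ASU q →ₐ[ℂ] ASU q))
    (ψ := (tau q g : ASU q →ₐ[ℂ] ASU q).comp (actKe q e)) (fun j => ?_) x
  change actKe q e (tau q g _) = tau q g (actKe q e _)
  cases j <;> simp only [actKe_gen, KGen, map_smul, tau_gen, tauGen] <;> rw [smul_comm]

/-- E shifts torus weights by (-1, -1): it sends a, of weight (1, 0), to c*, of weight (0, -1), and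
c, of weight (0, 1), to a*, of weight (-1, 0). -/
theorem actE_tau (q : Par) (g : Circle × Circle) (x : ASU q) :
    actE q (tau q g x) = ((g.1 * g.2 : Circle) : ℂ) • tau q g (actE q x) := by
  have h (u : Circle) : (u : ℂ) * starRingEnd ℂ (u : ℂ) = 1 := by simp [Complex.mul_conj]
  induction x using ASU.induction with
  | algebraMap z => simp [actE_algebraMap, AlgHomClass.commutes]
  | gen j =>
    cases j <;> simp only [tau_gen, tauGen, map_smul, actE_gen, EGen, map_zero, smul_zero,
      smul_smul, Circle.coe_mul]
    · congr 1; linear_combination ((g.1 : ℂ) * qc q) * h g.2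
    · congr 1; linear_combination -((g.2 : ℂ)) * h g.1
  | mul x y hx hy =>
    rw [map_mul, actE_mul, actE_mul, hx, hy, map_add, map_mul, map_mul, smul_mul_assoc,
      mul_smul_comm, ← smul_add, actKe_tau, actKe_tau]
  | add x y hx hy => simp only [map_add, hx, hy, smul_add]

theorem actE_pow_tau (q : Par) (g : Circle × Circle) (n : ℕ) (x : ASU q) :
    (actE q ^ n) (tau q g x) = ((g.1 * g.2 : Circle) : ℂ) ^ n • tau q g ((actE q ^ n) x) := by
  induction n generalizing x with
  | zero => simp
  | succ n ih => rw [pow_succ, Module.End.mul_apply, actE_tau, map_smul, ih, smul_smul, ← pow_succ']; rfl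

/-- `E` and `F` are adjoint to each other up to a factor: `(E ▷ x)^* = -q (F ▷ x^*)`. -/
theorem star_actE (q : Par) (x : ASU q) : star (actE q x) = (-qc q) • actF q (star x) := by
  -- The involution inverts K and reverses products, so it interchanges the two terms of the twisted
  -- Leibniz rule.
  have hK : ∀ (e : ℝ) (x : ASU q), star (actKe q e x) = actKe q (-e) (star x) := by
    intro e x
    have h (e : ℝ) : starRingEnd ℂ (qpow q e) = qpow q e := Complex.conj_ofReal _
    induction x using ASU.induction with
    | algebraMap z => rw [AlgHom.commutes, ASU.star_algebraMap, AlgHom.commutes]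
    | gen g =>
      cases g <;> simp only [actKe_gen, KGen, star_smul, ASU.star_gen, ASU.starGen, neg_neg] <;>
        rw [← starRingEnd_apply, h]
    | mul x y hx hy => rw [map_mul, star_mul, hx, hy, star_mul, map_mul]
    | add x y hx hy => rw [map_add, star_add, hx, hy, star_add, map_add]
  have hq : starRingEnd ℂ (qc q) = qc q := Complex.conj_ofReal _
  induction x using ASU.induction with
  | algebraMap z =>
    rw [actE_algebraMap, ASU.star_algebraMap, actF_algebraMap, star_zero, smul_zero]
  | gen g =>
    cases g <;> simp only [actE_gen, EGen, ASU.star_gen, ASU.starGen, actF_gen, FGen, star_smul,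
      star_zero, smul_zero, smul_smul]
    · rw [← starRingEnd_apply, map_neg, hq]
    · rw [neg_mul_neg, mul_inv_cancel₀ (qc_ne_zero q), one_smul]
  | mul x y hx hy =>
    rw [actE_mul, star_add, star_mul, star_mul, hx, hy, star_mul, actF_mul, hK, hK, neg_neg,
      mul_smul_comm, smul_mul_assoc, smul_add, add_comm]
  | add x y hx hy => rw [map_add, star_add, hx, hy, star_add, map_add, smul_add]

/-! ### The matrix elements span the coordinate algebra -/

theorem actE_pow_actKe (q : Par) (e : ℝ) (n : ℕ) {x : ASU q} (hx : (actE q ^ n) x = 0) :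
    (actE q ^ n) (actKe q e x) = 0 := by
  have : ∀ x, (actE q ^ n) (actKe q e x) = qpow q (-e) ^ n • actKe q e ((actE q ^ n) x) := by
    clear hx
    induction n with
    | zero => simp
    | succ n ih =>
      intro x
      rw [pow_succ, Module.End.mul_apply, actE_actKe, map_smul, ih, smul_smul, ← pow_succ']; rfl
  rw [this, hx, map_zero, smul_zero]

/-- By the Leibniz rule each E falls on one of the two factors, and K on the other factor does no
harm. With m + n - 1 applications, either x receives at least m of them or y at least n. -/
theorem actE_pow_mul (q : Par) (N : ℕ) : ∀ (m n : ℕ) (x y : ASU q), (actE q ^ m) x = 0 →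
    (actE q ^ n) y = 0 → m + n ≤ N + 1 → (actE q ^ N) (x * y) = 0 := by
  induction N with
  | zero =>
    intro m n x y hx hy h
    obtain rfl | rfl : m = 0 ∨ n = 0 := by omega
    · simp_all
    · simp_all
  | succ N ih =>
    intro m n x y hx hy h
    rcases m with _ | m
    · simp_all
    rcases n with _ | n
    · simp_all
    rw [pow_succ, Module.End.mul_apply, actE_mul, map_add,
      ih m (n + 1) _ _ (by rwa [pow_succ, Module.End.mul_apply] at hx) (actE_pow_actKe q _ _ hy)
        (by omega),
      ih (m + 1) n _ _ (actE_pow_actKe q _ _ hx) (by rwa [pow_succ, Module.End.mul_apply] at hy)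
        (by omega), add_zero]

theorem actE_pow_pow (q : Par) {x : ASU q} (hx : (actE q ^ 2) x = 0) (n : ℕ) :
    (actE q ^ (n + 1)) (x ^ n) = 0 := by
  induction n with
  | zero => simpa using actE_one q
  | succ n ih => rw [pow_succ x]; exact actE_pow_mul q _ _ _ _ _ ih hx (by omega)

/-! ### The action of E on monomials -/

theorem actE_ga (q : Par) : actE q (ga q) = -qc q • gcs q := actE_gen q .a
theorem actE_gc (q : Par) : actE q (gc q) = gas q := actE_gen q .c
theorem actE_gas (q : Par) : actE q (gas q) = 0 := actE_gen q .as
theorem actE_gcs (q : Par) : actE q (gcs q) = 0 := actE_gen q .cs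

theorem actE_pow_eq_zero (q : Par) {p j k : ℕ} (h : p + j < k) :
    (actE q ^ k) (ga q ^ p * gc q ^ j) = 0 := by
  obtain ⟨k, rfl⟩ : ∃ l, k = l + 1 := ⟨k - 1, by omega⟩
  refine actE_pow_mul q _ (p + 1) (j + 1) _ _ (actE_pow_pow q ?_ _) (actE_pow_pow q ?_ _) (by omega)
  · rw [pow_two, Module.End.mul_apply, actE_ga, map_smul, actE_gcs, smul_zero]
  · rw [pow_two, Module.End.mul_apply, actE_gc, actE_gas]

/-- The square root of `q`. -/
def sqr (q : Par) : ℝ := (q : ℝ) ^ (1 / 2 : ℝ)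

theorem sqr_pos (q : Par) : 0 < sqr q := Real.rpow_pos_of_pos q.2.1 _

theorem sqr_ne_zero (q : Par) : (sqr q : ℂ) ≠ 0 := by
  exact_mod_cast (sqr_pos q).ne'

theorem qc_eq_sq (q : Par) : qc q = (sqr q : ℂ) ^ 2 := by
  change qc q = qpow q (1 / 2) ^ 2
  rw [pow_two, qpow_add, ← qpow_one]; norm_num

theorem qpow_neg_half (q : Par) : qpow q (-(1 / 2)) = (sqr q : ℂ)⁻¹ := by
  refine eq_inv_of_mul_eq_one_right ?_
  change qpow q (1 / 2) * _ = 1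
  rw [qpow_add, ← qpow_zero q]; norm_num

theorem actKe_one_pow (q : Par) (n : ℕ) :
    actKe q 1 (ga q ^ n) = (sqr q : ℂ)⁻¹ ^ n • ga q ^ n ∧
    actKe q 1 (gc q ^ n) = (sqr q : ℂ)⁻¹ ^ n • gc q ^ n ∧
    actKe q 1 (gcs q ^ n) = (sqr q : ℂ) ^ n • gcs q ^ n := by
  have h : qpow q (-1 / 2) = (sqr q : ℂ)⁻¹ := by rw [← qpow_neg_half, neg_div]
  refine ⟨?_, ?_, ?_⟩ <;> rw [map_pow]
  · rw [ga, actKe_gen, KGen, smul_pow, h]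
  · rw [gc, actKe_gen, KGen, smul_pow, h]
  · rw [gcs, actKe_gen, KGen, smul_pow]; rfl

theorem actKe_neg_one_pow (q : Par) (n : ℕ) :
    actKe q (-1) (ga q ^ n) = (sqr q : ℂ) ^ n • ga q ^ n ∧
    actKe q (-1) (gc q ^ n) = (sqr q : ℂ) ^ n • gc q ^ n ∧
    actKe q (-1) (gas q ^ n) = (sqr q : ℂ)⁻¹ ^ n • gas q ^ n := by
  have h : qpow q (-1 / 2) = (sqr q : ℂ)⁻¹ := by rw [← qpow_neg_half, neg_div]
  have h' : qpow q (-(-1) / 2) = (sqr q : ℂ) := by rw [neg_neg]; rfl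
  refine ⟨?_, ?_, ?_⟩ <;> rw [map_pow]
  · rw [ga, actKe_gen, KGen, smul_pow, h']
  · rw [gc, actKe_gen, KGen, smul_pow, h']
  · rw [gas, actKe_gen, KGen, smul_pow, h]

theorem actE_gas_pow (q : Par) (n : ℕ) : actE q (gas q ^ n) = 0 := by
  induction n with
  | zero => simpa using actE_one q
  | succ n ih => rw [pow_succ, actE_mul, ih, actE_gas, zero_mul, mul_zero, add_zero]

theorem actE_gcs_pow (q : Par) (n : ℕ) : actE q (gcs q ^ n) = 0 := by
  induction n with
  | zero => simpa using actE_one q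
  | succ n ih => rw [pow_succ, actE_mul, ih, actE_gcs, zero_mul, mul_zero, add_zero]

/-- The coefficient in `E ▷ c^{m+1}`. -/
def cCoef (q : Par) (m : ℕ) : ℝ := (sqr q)⁻¹ ^ m * ∑ j ∈ Finset.range (m + 1), (sqr q ^ 4) ^ j

theorem cCoef_pos (q : Par) (m : ℕ) : 0 < cCoef q m := by
  have := sqr_pos q
  unfold cCoef
  refine mul_pos (by positivity) (Finset.sum_pos (fun _ _ => by positivity) ⟨0, by simp⟩)

theorem actE_gc_pow (q : Par) (m : ℕ) :
    actE q (gc q ^ (m + 1)) = (cCoef q m : ℂ) • (gas q * gc q ^ m) := by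
  induction m with
  | zero => simp [cCoef, actE_gc]
  | succ m ih =>
    have h1 := (actKe_neg_one_pow q 1).2.1
    rw [pow_one, pow_one] at h1
    rw [pow_succ', actE_mul, actE_gc, ih, (actKe_one_pow q _).2.1, h1, smul_mul_smul_comm,
      ← mul_assoc, c_mul_as, smul_mul_assoc, mul_assoc, ← pow_succ', mul_smul_comm, smul_smul,
      ← add_smul]
    congr 1
    have h2 : (sqr q : ℂ) ^ 4 * (sqr q : ℂ)⁻¹ = (sqr q : ℂ) ^ 3 := by
      rw [pow_succ, mul_assoc, mul_inv_cancel₀ (sqr_ne_zero q), mul_one]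
    rw [cCoef, cCoef, qc_eq_sq, Finset.sum_range_succ' _ (m + 1)]
    simp only [pow_succ (sqr q ^ 4) _, ← Finset.sum_mul]
    push_cast
    generalize ∑ x ∈ Finset.range (m + 1), ((sqr q : ℂ) ^ 4) ^ x = S
    linear_combination -((sqr q : ℂ)⁻¹ ^ m * S) * h2

/-- Only the sign of the coefficient matters: in `actE_nmon_pos` it is added to another negative
contribution, so nothing can cancel. -/
theorem actE_ga_pow (q : Par) (i : ℕ) :
    ∃ r : ℝ, 0 < r ∧ actE q (ga q ^ (i + 1)) = (-r : ℂ) • (ga q ^ i * gcs q) := by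
  have hs := sqr_pos q
  induction i with
  | zero => exact ⟨q, q.2.1, by simp [actE_ga, qc]⟩
  | succ i ih =>
    obtain ⟨r, hr, h⟩ := ih
    have h1 := (actKe_neg_one_pow q 1).1
    rw [pow_one, pow_one] at h1
    refine ⟨q * ((sqr q)⁻¹ ^ (i + 1) * (q : ℝ)⁻¹ ^ (i + 1)) + sqr q * r,
      by have := q.2.1; positivity, ?_⟩
    rw [pow_succ', actE_mul, actE_ga, h, (actKe_one_pow q _).1, h1, smul_mul_smul_comm,
      smul_mul_smul_comm, ← mul_assoc, ← pow_succ', mul_pow_of_smul_comm (cs_mul_a q),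
      smul_smul, ← add_smul]
    congr 1
    rw [qc]
    push_cast
    ring

/-- E kills a* and c*, so only the factor c^{m+1} contributes. -/
theorem actE_nmon_neg (q : Par) (i m n : ℕ) :
    ∃ z : ℂ, z ≠ 0 ∧ actE q (nmon q (-(i : ℤ)) (m + 1) n) = z • nmon q (-((i : ℤ) + 1)) m n := by
  refine ⟨(sqr q : ℂ)⁻¹ ^ i * (cCoef q m * (sqr q : ℂ) ^ n), ?_, ?_⟩
  · have := sqr_ne_zero q
    have : (cCoef q m : ℂ) ≠ 0 := by exact_mod_cast (cCoef_pos q m).ne'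
    positivity
  · rw [nmon, nmon, apow_neg_natCast, apow_neg_succ, actE_mul, actE_gas_pow, zero_mul, zero_add,
      actE_mul, actE_gcs_pow, mul_zero, add_zero, actE_gc_pow, (actKe_neg_one_pow q i).2.2,
      (actKe_one_pow q n).2.2, smul_mul_smul_comm, smul_mul_smul_comm, pow_succ (gas q)]
    simp only [mul_assoc]

/-- Acting on the power of a, E produces c*. Acting on c^m, it produces a*, which an adjacent a
absorbs through aa* = 1 - q²cc*. The cc* part has the same sign as the first contribution, whence z
≠ 0. For m = 0 the truncated m - 1 is harmless, as w = 0 is taken. -/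
theorem actE_nmon_pos (q : Par) (i m n : ℕ) :
    ∃ z w : ℂ, z ≠ 0 ∧ actE q (nmon q ((i : ℤ) + 1) m n) =
      z • nmon q i m (n + 1) + w • nmon q i (m - 1) n := by
  obtain ⟨r, hr, hE⟩ := actE_ga_pow q i
  have hs := sqr_pos q
  have hcn : gcs q * gc q ^ m = gc q ^ m * gcs q := ((commute_c_cs q).symm.pow_right m).eq
  rw [nmon, nmon, nmon, show ((i : ℤ) + 1) = ((i + 1 : ℕ) : ℤ) by push_cast; rfl, apow_natCast,
    apow_natCast, ← mul_assoc, actE_mul, actE_gcs_pow, mul_zero, add_zero, actE_mul, hE,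
    (actKe_one_pow q n).2.2, (actKe_one_pow q m).2.1, (actKe_neg_one_pow q _).1]
  rcases m with _ | m
  · refine ⟨(-r : ℂ) * (sqr q : ℂ) ^ n, 0, ?_, ?_⟩
    · have := sqr_ne_zero q
      have : (-r : ℂ) ≠ 0 := by exact_mod_cast (neg_neg_of_pos hr).ne
      positivity
    · simp only [pow_zero, actE_one, mul_zero, add_zero, one_smul, mul_one, one_mul,
        smul_mul_smul_comm, zero_smul, pow_succ' (gcs q), mul_assoc]
  · refine ⟨-((r * (sqr q)⁻¹ ^ (m + 1) + (sqr q) ^ (i + 1) * cCoef q m * q ^ 2) * sqr q ^ n : ℝ),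
      (sqr q : ℂ) ^ (i + 1) * cCoef q m * sqr q ^ n, ?_, ?_⟩
    · have := cCoef_pos q m
      have := q.2.1
      exact_mod_cast (neg_neg_of_pos (by positivity)).ne
    · have h1 : ga q ^ (i + 1) * (gas q * gc q ^ m) =
          ga q ^ i * gc q ^ m - (qc q ^ 2) • (ga q ^ i * gc q ^ (m + 1) * gcs q) := by
        rw [pow_succ (ga q), mul_assoc, ← mul_assoc (ga q) (gas q), a_mul_as, sub_mul, one_mul,
          mul_sub, smul_mul_assoc, mul_smul_comm, mul_assoc (gc q),
          ((commute_c_cs q).symm.pow_right m).eq, ← mul_assoc (gc q), ← pow_succ' (gc q),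
          ← mul_assoc (ga q ^ i)]
      rw [actE_gc_pow, smul_mul_smul_comm, smul_mul_smul_comm, h1, mul_assoc (ga q ^ i), hcn,
        ← mul_assoc (ga q ^ i), pow_succ' (gcs q), Nat.add_sub_cancel]
      simp only [smul_sub, add_mul, sub_mul, smul_mul_assoc, mul_smul_comm, mul_assoc, qc]
      match_scalars
      · ring
      · ring

theorem qnum_pos (q : Par) {s : ℝ} (hs : 0 < s) : 0 < qnum q s := by
  have h0 := q.2.1
  have h1 := q.2.2
  unfold qnum
  refine div_pos (sub_pos.2 (Real.rpow_lt_rpow_of_exponent_gt h0 h1 (by linarith))) ?_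
  exact sub_pos.2 (h1.trans (one_lt_inv₀ h0 |>.2 h1))

theorem qpow_ne_zero (q : Par) (x : ℝ) : qpow q x ≠ 0 := by
  exact Complex.ofReal_ne_zero.2 (Real.rpow_pos_of_pos q.2.1 x).ne'

/-- `t^l_{mn}` is a nonzero multiple of `E^{l+n} ▷ (a^{l-m} c^{l+m})`. -/
theorem matEl_eq (q : Par) (i : Lab) : ∃ z : ℂ, z ≠ 0 ∧ matEl q i =
    z • (actE q ^ (i.2.2 : ℕ)) (ga q ^ (i.1 - (i.2.1 : ℕ)) * gc q ^ (i.2.1 : ℕ)) := by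
  rw [matEl, map_smul, smul_smul]
  refine ⟨_, ?_, rfl⟩
  have h (k : Fin (i.1 + 1)) (s : ℕ) (hs : s ∈ Finset.range k) : (0 : ℝ) < i.1 - s := by
    have h1 := Finset.mem_range.1 hs
    have h2 := k.2
    rw [sub_pos]
    exact_mod_cast (by omega : s < i.1)
  refine mul_ne_zero ?_ (mul_ne_zero (qpow_ne_zero q _) ?_)
  · refine Complex.ofReal_ne_zero.2 (inv_ne_zero (Finset.prod_ne_zero_iff.2 fun s hs => ?_))
    exact (Real.sqrt_pos.2 (mul_pos (qnum_pos q (h _ s hs)) (qnum_pos q (by positivity)))).ne'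
  · refine Complex.ofReal_ne_zero.2 (Real.sqrt_pos.2 (Finset.prod_pos fun s hs => ?_)).ne'
    exact div_pos (qnum_pos q (h _ s hs)) (qnum_pos q (by positivity))

/-- The span T is stable under E and contains a^i c^m. Each application of E to a monomial in T
gives one new monomial with a nonzero coefficient, plus at most a term already in T, so every
normally ordered monomial is reached. -/
theorem span_matEl (q : Par) : Submodule.span ℂ (Set.range (matEl q)) = ⊤ := by
  set T := Submodule.span ℂ (Set.range (matEl q)) with hT
  have hmem : ∀ p j k : ℕ, (actE q ^ k) (ga q ^ p * gc q ^ j) ∈ T := by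
    intro p j k
    by_cases h : p + j < k
    · rw [actE_pow_eq_zero q h]; exact zero_mem _
    · obtain ⟨z, hz, h'⟩ := matEl_eq q ⟨p + j, ⟨j, by omega⟩, ⟨k, by omega⟩⟩
      rw [← inv_smul_smul₀ hz ((actE q ^ k) (ga q ^ p * gc q ^ j))]
      refine Submodule.smul_mem _ _ ?_
      simp only [Nat.add_sub_cancel] at h'
      rw [← h']
      exact Submodule.subset_span ⟨_, rfl⟩
  -- Dropping the bound k ≤ p + j adds only zeros and makes stability under E immediate.
  have hT' : T = Submodule.span ℂ
      (Set.range fun p : ℕ × ℕ × ℕ => (actE q ^ p.2.2) (ga q ^ p.1 * gc q ^ p.2.1)) := by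
    refine le_antisymm (Submodule.span_le.2 ?_) (Submodule.span_le.2 ?_)
    · rintro _ ⟨i, rfl⟩
      obtain ⟨z, -, h⟩ := matEl_eq q i
      rw [h]
      exact Submodule.smul_mem _ _ (Submodule.subset_span ⟨(_, _, _), rfl⟩)
    · rintro _ ⟨p, rfl⟩
      exact hmem _ _ _
  have hE : ∀ x ∈ T, actE q x ∈ T := by
    intro x hx
    rw [hT'] at hx
    induction hx using Submodule.span_induction with
    | mem x hx =>
      obtain ⟨p, rfl⟩ := hx
      have := hmem p.1 p.2.1 (p.2.2 + 1)
      rwa [pow_succ', Module.End.mul_apply] at this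
    | zero => simp
    | add x y _ _ hx hy => rw [map_add]; exact add_mem hx hy
    | smul z x _ hx => rw [map_smul]; exact Submodule.smul_mem _ _ hx
  -- Induction on n: `actE_nmon_pos` is solved for the term with exponent n + 1 of c*, the other
  -- term having exponent n.
  have hpos : ∀ n i m : ℕ, nmon q i m n ∈ T := by
    intro n
    induction n with
    | zero => intro i m; simpa [nmon, apow_natCast] using hmem i m 0
    | succ n ih =>
      intro i m
      obtain ⟨z, w, hz, h⟩ := actE_nmon_pos q i m n
      rw [← inv_smul_smul₀ hz (nmon q i m (n + 1)), ← sub_eq_of_eq_add h]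
      refine Submodule.smul_mem _ _ (sub_mem (hE _ ?_) (Submodule.smul_mem _ _ (ih _ _)))
      exact_mod_cast ih (i + 1) m
  -- Induction on i: E turns one factor c into one more a*.
  have hneg : ∀ i m n : ℕ, nmon q (-(i : ℤ)) m n ∈ T := by
    intro i
    induction i with
    | zero => intro m n; simpa using hpos n 0 m
    | succ i ih =>
      intro m n
      obtain ⟨z, hz, h⟩ := actE_nmon_neg q i m n
      push_cast
      rw [← inv_smul_smul₀ hz (nmon q _ m n), ← h]
      exact Submodule.smul_mem _ _ (hE _ (ih _ _))
  refine eq_top_iff.2 fun x _ => ?_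
  induction x using nmon_induction with
  | nmon i m n =>
    induction i using apow_cases with
    | h1 i => exact hpos _ _ _
    | h2 i => exact_mod_cast hneg (i + 1) m n
  | zero => exact zero_mem _
  | add x y hx hy => exact add_mem (hx trivial) (hy trivial)
  | smul z x hx => exact Submodule.smul_mem _ _ (hx trivial)

/-! ### Weighted shifts -/

section wshift
variable {ι : Type*}

theorem memLp_wshift (w : ι → ℂ) {s : ι → ι} (hs : Function.Injective s) (hw : ∀ i, ‖w i‖ ≤ 1)
    (ψ : lp (fun _ : ι => ℂ) 2) : Memℓp (fun i => w i * ψ (s i)) 2 ∧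
      ∑' i, ‖w i * ψ (s i)‖ ^ (2 : ℝ≥0∞).toReal ≤ ‖ψ‖ ^ (2 : ℝ≥0∞).toReal := by
  have h0 : 0 < (2 : ℝ≥0∞).toReal := by norm_num
  have h1 : Summable fun i => ‖ψ i‖ ^ (2 : ℝ≥0∞).toReal := (lp.memℓp ψ).summable h0
  have h2 : Summable fun i => ‖ψ (s i)‖ ^ (2 : ℝ≥0∞).toReal := h1.comp_injective hs
  have h3 : ∀ i, ‖w i * ψ (s i)‖ ^ (2 : ℝ≥0∞).toReal ≤ ‖ψ (s i)‖ ^ (2 : ℝ≥0∞).toReal := by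
    intro i
    refine Real.rpow_le_rpow (norm_nonneg _) ?_ h0.le
    rw [norm_mul]
    exact mul_le_of_le_one_left (norm_nonneg _) (hw i)
  have h4 : Summable fun i => ‖w i * ψ (s i)‖ ^ (2 : ℝ≥0∞).toReal :=
    Summable.of_nonneg_of_le (fun i => by positivity) h3 h2
  refine ⟨memℓp_gen h4, (h4.tsum_le_tsum h3 h2).trans ?_⟩
  rw [lp.norm_rpow_eq_tsum h0]
  exact tsum_comp_le_tsum_of_inj h1 (fun i => by positivity) hs

/-- The operator `(T ψ)(i) = w(i) ψ(s(i))` on `ℓ²(ι)`. -/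
def wshift (w : ι → ℂ) (s : ι → ι) (hs : Function.Injective s) (hw : ∀ i, ‖w i‖ ≤ 1) :
    lp (fun _ : ι => ℂ) 2 →L[ℂ] lp (fun _ : ι => ℂ) 2 :=
  LinearMap.mkContinuous
    { toFun := fun ψ => ⟨fun i => w i * ψ (s i), (memLp_wshift w hs hw ψ).1⟩
      map_add' := fun ψ φ => by ext i; exact mul_add _ _ _
      map_smul' := fun z ψ => by ext i; simp [mul_left_comm] } 1 fun ψ => by
    rw [one_mul]
    exact lp.norm_le_of_tsum_le (by norm_num) (norm_nonneg _) (memLp_wshift w hs hw ψ).2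

variable {w : ι → ℂ} {s : ι → ι} {hs : Function.Injective s} {hw : ∀ i, ‖w i‖ ≤ 1}

theorem wshift_apply (ψ : lp (fun _ : ι => ℂ) 2) (i : ι) :
    wshift w s hs hw ψ i = w i * ψ (s i) := rfl

variable [DecidableEq ι]

/-- The standard basis vectors of `ℓ²(ι)`. -/
def ebasis (i : ι) : lp (fun _ : ι => ℂ) 2 := lp.single 2 i 1

theorem ebasis_apply (i j : ι) : ebasis i j = if j = i then 1 else 0 := by
  rw [ebasis, lp.single_apply, Pi.single_apply]

theorem inner_ebasis (i : ι) (ψ : lp (fun _ : ι => ℂ) 2) : inner ℂ (ebasis i) ψ = ψ i := by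
  rw [ebasis, lp.inner_single_left]; simp

theorem wshift_ebasis (i : ι) : wshift w s hs hw (ebasis (s i)) = w i • ebasis i := by
  ext j
  rw [wshift_apply, ebasis_apply, lp.coeFn_smul, Pi.smul_apply, ebasis_apply, smul_eq_mul]
  by_cases h : j = i
  · simp [h]
  · simp [h, hs.eq_iff]

theorem wshift_ebasis_of_notMem {p : ι} (h : ∀ i, s i ≠ p) : wshift w s hs hw (ebasis p) = 0 := by
  ext j
  rw [wshift_apply, ebasis_apply, if_neg (h j), mul_zero]; rfl

theorem star_wshift_apply (ψ : lp (fun _ : ι => ℂ) 2) (i : ι) :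
    star (wshift w s hs hw) ψ (s i) = starRingEnd ℂ (w i) * ψ i := by
  rw [← inner_ebasis, ContinuousLinearMap.star_eq_adjoint, ContinuousLinearMap.adjoint_inner_right,
    wshift_ebasis, inner_smul_left, inner_ebasis]

theorem star_wshift_apply_of_notMem (ψ : lp (fun _ : ι => ℂ) 2) {p : ι} (h : ∀ i, s i ≠ p) :
    star (wshift w s hs hw) ψ p = 0 := by
  rw [← inner_ebasis, ContinuousLinearMap.star_eq_adjoint, ContinuousLinearMap.adjoint_inner_right,
    wshift_ebasis_of_notMem h, inner_zero_left]

theorem star_wshift_ebasis (i : ι) :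
    star (wshift w s hs hw) (ebasis i) = starRingEnd ℂ (w i) • ebasis (s i) := by
  ext p
  rw [lp.coeFn_smul, Pi.smul_apply, ebasis_apply, smul_eq_mul]
  by_cases h : ∃ j, s j = p
  · obtain ⟨j, rfl⟩ := h
    rw [star_wshift_apply, ebasis_apply]
    by_cases h : j = i
    · simp [h]
    · simp [h, hs.eq_iff]
  · push Not at h
    rw [star_wshift_apply_of_notMem _ h, if_neg (h i).symm, mul_zero]

end wshift

/-! ### The representation on `ℓ²(ℕ × ℤ)` -/

/-- The Hilbert space `ℓ²(ℕ × ℤ)`. -/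
abbrev HSp : Type := lp (fun _ : ℕ × ℤ => ℂ) 2

/-- The weights `(1 - q^{2k+2})^{1/2}`. -/
def aw (q : Par) (k : ℕ) : ℂ := (√(1 - (q : ℝ) ^ (2 * (k + 1))) : ℝ)

theorem one_sub_pow_pos (q : Par) {k : ℕ} (hk : k ≠ 0) : 0 < 1 - (q : ℝ) ^ k :=
  sub_pos.2 (pow_lt_one₀ q.2.1.le q.2.2 hk)

theorem aw_sq (q : Par) (k : ℕ) : aw q k * aw q k = 1 - qc q ^ (2 * (k + 1)) := by
  rw [aw, ← Complex.ofReal_mul, Real.mul_self_sqrt (one_sub_pow_pos q (by omega)).le, qc]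
  push_cast; rfl

theorem aw_ne_zero (q : Par) (k : ℕ) : aw q k ≠ 0 :=
  Complex.ofReal_ne_zero.2 (Real.sqrt_pos.2 (one_sub_pow_pos q (by omega))).ne'

theorem conj_aw (q : Par) (k : ℕ) : starRingEnd ℂ (aw q k) = aw q k := Complex.conj_ofReal _
theorem conj_qc (q : Par) : starRingEnd ℂ (qc q) = qc q := Complex.conj_ofReal _

theorem norm_aw_le (q : Par) (k : ℕ) : ‖aw q k‖ ≤ 1 := by
  rw [aw, Complex.norm_real, Real.norm_of_nonneg (Real.sqrt_nonneg _), Real.sqrt_le_one]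
  linarith [pow_pos q.2.1 (2 * (k + 1))]

theorem norm_qc (q : Par) : ‖qc q‖ = q := by
  rw [qc, Complex.norm_real, Real.norm_of_nonneg q.2.1.le]

theorem norm_qc_pow_le (q : Par) (k : ℕ) : ‖qc q ^ k‖ ≤ 1 := by
  rw [norm_pow, norm_qc]; exact pow_le_one₀ q.2.1.le q.2.2.le

theorem shiftA_injective : Function.Injective fun p : ℕ × ℤ => (p.1 + 1, p.2) :=
  fun x y h => by ext <;> simp_all
theorem shiftC_injective : Function.Injective fun p : ℕ × ℤ => (p.1, p.2 - 1) :=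
  fun x y h => by ext <;> simp_all

/-- The operator `e_{k,r} ↦ (1 - q^{2k})^{1/2} e_{k-1,r}`. -/
def opA (q : Par) : HSp →L[ℂ] HSp :=
  wshift (fun p : ℕ × ℤ => aw q p.1) (fun p => (p.1 + 1, p.2))
    shiftA_injective fun p => norm_aw_le q p.1

/-- The operator `e_{k,r} ↦ q^k e_{k,r+1}`. -/
def opC (q : Par) : HSp →L[ℂ] HSp :=
  wshift (fun p : ℕ × ℤ => qc q ^ p.1) (fun p => (p.1, p.2 - 1))
    shiftC_injective fun p => norm_qc_pow_le q p.1

theorem opA_apply (q : Par) (ψ : HSp) (k : ℕ) (r : ℤ) :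
    opA q ψ (k, r) = aw q k * ψ (k + 1, r) := rfl
theorem opC_apply (q : Par) (ψ : HSp) (k : ℕ) (r : ℤ) :
    opC q ψ (k, r) = qc q ^ k * ψ (k, r - 1) := rfl

theorem star_opA_succ (q : Par) (ψ : HSp) (k : ℕ) (r : ℤ) :
    star (opA q) ψ (k + 1, r) = aw q k * ψ (k, r) := by
  rw [opA, ← conj_aw]; exact star_wshift_apply ψ (k, r)
theorem star_opA_zero (q : Par) (ψ : HSp) (r : ℤ) : star (opA q) ψ (0, r) = 0 :=
  star_wshift_apply_of_notMem ψ fun i => by simp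
theorem star_opC_apply (q : Par) (ψ : HSp) (k : ℕ) (r : ℤ) :
    star (opC q) ψ (k, r) = qc q ^ k * ψ (k, r + 1) := by
  have := star_wshift_apply (w := fun p : ℕ × ℤ => qc q ^ p.1) (s := fun p => (p.1, p.2 - 1))
    (hs := shiftC_injective) (hw := fun p => norm_qc_pow_le q p.1) ψ (k, r + 1)
  simp only [map_pow, conj_qc, add_sub_cancel_right] at this
  exact this

/-- The operators representing the generators. -/
def opGen (q : Par) : Gen → HSp →L[ℂ] HSp
  | .a => opA q
  | .as => star (opA q)
  | .c => opC q
  | .cs => star (opC q)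

theorem sat_op (q : Par) : ASU.Sat q (opGen q) := by
  have ac : opA q * opC q = qc q • (opC q * opA q) := by
    ext ψ ⟨k, r⟩
    change opA q (opC q ψ) (k, r) = qc q * opC q (opA q ψ) (k, r)
    simp only [opA_apply, opC_apply]; ring
  have acs : opA q * star (opC q) = qc q • (star (opC q) * opA q) := by
    ext ψ ⟨k, r⟩
    change opA q (star (opC q) ψ) (k, r) = qc q * star (opC q) (opA q ψ) (k, r)
    simp only [opA_apply, star_opC_apply]; ring
  refine ⟨ac, acs, ?_, ?_, ?_, ?_, ?_⟩ <;> simp only [opGen]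
  · have := congrArg star ac
    rwa [star_smul, star_mul, star_mul, ← starRingEnd_apply, conj_qc] at this
  · have := congrArg star acs
    rwa [star_smul, star_mul, star_mul, star_star, ← starRingEnd_apply, conj_qc] at this
  · ext ψ ⟨k, r⟩
    change opC q (star (opC q) ψ) (k, r) = star (opC q) (opC q ψ) (k, r)
    simp only [opC_apply, star_opC_apply]; ring_nf
  · ext ψ ⟨k, r⟩
    change star (opA q) (opA q ψ) (k, r) + star (opC q) (opC q ψ) (k, r) = ψ (k, r)
    rw [star_opC_apply, opC_apply]
    -- No a* reaches a vector with k = 0, but there c*c already acts as the identity.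
    cases k with
    | zero => rw [star_opA_zero]; simp
    | succ k =>
      rw [star_opA_succ, opA_apply, add_sub_cancel_right]
      linear_combination ψ (k + 1, r) * aw_sq q k
  · ext ψ ⟨k, r⟩
    change opA q (star (opA q) ψ) (k, r) + qc q ^ 2 * opC q (star (opC q) ψ) (k, r) = ψ (k, r)
    rw [opA_apply, star_opA_succ, opC_apply, star_opC_apply, sub_add_cancel]
    linear_combination ψ (k, r) * aw_sq q k

instance : Nontrivial (HSp →L[ℂ] HSp) := by
  refine ⟨⟨1, 0, fun h => ?_⟩⟩
  have := congrArg (fun ψ : HSp => ψ (0, 0))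
    (DFunLike.congr_fun h (ebasis ((0, 0) : ℕ × ℤ)))
  simp [ebasis_apply] at this

/-- The representation of `A(SU_q(2))` on `ℓ²(ℕ × ℤ)`. -/
def opHom (q : Par) : ASU q →⋆ₐ[ℂ] (HSp →L[ℂ] HSp) where
  __ := ASU.lift (opGen q) (sat_op q)
  map_star' x := by
    change ASU.lift (opGen q) (sat_op q) (star x) = star (ASU.lift (opGen q) (sat_op q) x)
    induction x using ASU.induction with
    | algebraMap z =>
      rw [ASU.star_algebraMap, AlgHom.commutes, AlgHom.commutes, ← algebraMap_star_comm]; rfl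
    | gen g => cases g <;> simp [ASU.star_gen, ASU.starGen, opGen]
    | mul x y hx hy => simp [hx, hy]
    | add x y hx hy => simp [hx, hy]

/-! ### Matrix coefficients of the representation and its faithfulness -/

theorem opHom_gen (q : Par) (g : Gen) : opHom q (ASU.gen q g) = opGen q g :=
  ASU.lift_gen _ (sat_op q) _

/-- The standard basis vector `e_{k,r}`. -/
abbrev ev (k : ℕ) (r : ℤ) : HSp := ebasis (k, r)

theorem op_a_succ (q : Par) (k : ℕ) (r : ℤ) :
    opHom q (ga q) (ev (k + 1) r) = aw q k • ev k r := by
  rw [ga, opHom_gen]; exact wshift_ebasis (hs := shiftA_injective) (hw := fun p => norm_aw_le q p.1) ((k, r) : ℕ × ℤ)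
theorem op_a_zero (q : Par) (r : ℤ) : opHom q (ga q) (ev 0 r) = 0 := by
  rw [ga, opHom_gen]; exact wshift_ebasis_of_notMem (hs := shiftA_injective) (hw := fun p => norm_aw_le q p.1)
    fun i => by simp
theorem op_as (q : Par) (k : ℕ) (r : ℤ) :
    opHom q (gas q) (ev k r) = aw q k • ev (k + 1) r := by
  rw [gas, opHom_gen, ← conj_aw]
  exact star_wshift_ebasis (hs := shiftA_injective) (hw := fun p => norm_aw_le q p.1) (k, r)
theorem op_c (q : Par) (k : ℕ) (r : ℤ) :
    opHom q (gc q) (ev k r) = qc q ^ k • ev k (r + 1) := by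
  rw [gc, opHom_gen]
  have := wshift_ebasis (w := fun p : ℕ × ℤ => qc q ^ p.1) (s := fun p => (p.1, p.2 - 1))
    (hs := shiftC_injective) (hw := fun p => norm_qc_pow_le q p.1) (k, r + 1)
  simp only [add_sub_cancel_right] at this
  exact this
theorem op_cs (q : Par) (k : ℕ) (r : ℤ) :
    opHom q (gcs q) (ev k r) = qc q ^ k • ev k (r - 1) := by
  rw [gcs, opHom_gen]
  have := star_wshift_ebasis (w := fun p : ℕ × ℤ => qc q ^ p.1) (s := fun p => (p.1, p.2 - 1))
    (hs := shiftC_injective) (hw := fun p => norm_qc_pow_le q p.1) (k, r)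
  simp only [map_pow, conj_qc] at this
  exact this

theorem op_c_pow_cs_pow (q : Par) (m n k : ℕ) (r : ℤ) :
    opHom q (gc q ^ m * gcs q ^ n) (ev k r) = (qc q ^ k) ^ (m + n) • ev k (r + m - n) := by
  have hcs : ∀ (n : ℕ) (r : ℤ), opHom q (gcs q ^ n) (ev k r) = (qc q ^ k) ^ n • ev k (r - n) := by
    intro n
    induction n with
    | zero => simp
    | succ n ih =>
      intro r
      rw [pow_succ, map_mul, mul_apply_eq_comp, op_cs, map_smul, ih, smul_smul,
        ← pow_succ']
      congr 2; push_cast; ring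
  have hc : ∀ (n : ℕ) (r : ℤ), opHom q (gc q ^ n) (ev k r) = (qc q ^ k) ^ n • ev k (r + n) := by
    intro n
    induction n with
    | zero => simp
    | succ n ih =>
      intro r
      rw [pow_succ, map_mul, mul_apply_eq_comp, op_c, map_smul, ih, smul_smul,
        ← pow_succ']
      congr 2; push_cast; ring
  rw [map_mul, mul_apply_eq_comp, hcs, map_smul, hc, smul_smul, ← pow_add, add_comm n]
  congr 2; ring

theorem op_apow (q : Par) (i : ℤ) (k : ℕ) :
    ∃ z : ℂ, (∀ r, opHom q (apow q i) (ev k r) = z • ev (k - i).toNat r) ∧ (i ≤ k → z ≠ 0) ∧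
      (k < i → z = 0) ∧ (i = 0 → z = 1) := by
  induction i using apow_cases with
  | h1 n =>
    rw [apow_natCast]
    induction n generalizing k with
    | zero => exact ⟨1, by simp⟩
    | succ n ih =>
      simp only [pow_succ, map_mul, mul_apply_eq_comp]
      cases k with
      | zero =>
        exact ⟨0, fun r => by rw [op_a_zero, map_zero, zero_smul], by omega, by simp, by omega⟩
      | succ k =>
        obtain ⟨z, h1, h2, h3, -⟩ := ih k
        refine ⟨aw q k * z, fun r => ?_, fun h => ?_, fun h => ?_, by omega⟩
        · rw [op_a_succ, map_smul, h1, smul_smul]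
          congr 3; push_cast; ring
        · exact mul_ne_zero (aw_ne_zero q k) (h2 (by omega))
        · rw [h3 (by omega), mul_zero]
  | h2 n =>
    rw [apow_neg_succ]
    obtain ⟨z, h1, h2⟩ : ∃ z : ℂ, (∀ r, opHom q (gas q ^ (n + 1)) (ev k r) =
        z • ev (k + (n + 1)) r) ∧ z ≠ 0 := by
      induction n + 1 generalizing k with
      | zero => exact ⟨1, by simp⟩
      | succ n ih =>
        obtain ⟨z, h1, h2⟩ := ih (k + 1)
        refine ⟨aw q k * z, fun r => ?_, mul_ne_zero (aw_ne_zero q k) h2⟩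
        rw [pow_succ, map_mul, mul_apply_eq_comp, op_as, map_smul, h1, smul_smul, add_right_comm,
          add_assoc]
    refine ⟨z, fun r => ?_, fun _ => h2, by omega, by omega⟩
    rw [h1]; congr 2

/-- The scalar z depends on i and k only, so m and n enter the coefficient through (q^k)^{m+n}
alone. The truncation in `toNat` is harmless because z = 0 when k < i. -/
theorem op_nmon (q : Par) (i : ℤ) (k : ℕ) :
    ∃ z : ℂ, (∀ m n : ℕ, opHom q (nmon q i m n) (ev k 0) =
      ((qc q ^ k) ^ (m + n) * z) • ev (k - i).toNat (m - n)) ∧ (i ≤ k → z ≠ 0) ∧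
      (k < i → z = 0) ∧ (i = 0 → z = 1) := by
  obtain ⟨z, hz, h⟩ := op_apow q i k
  refine ⟨z, fun m n => ?_, h⟩
  rw [nmon, map_mul, mul_apply_eq_comp, op_c_pow_cs_pow, map_smul, hz, smul_smul, zero_add]

/-- The representation on `ℓ²(ℕ × ℤ)` is faithful on `A(SU_q(2))`. -/
theorem eq_zero_of_opHom_eq_zero (q : Par) (x : ASU q) (hx : opHom q x = 0) : x = 0 := by
  have hmem : x ∈ nspan q := nspan_eq_top q ▸ Submodule.mem_top
  obtain ⟨c, rfl⟩ := (Finsupp.mem_span_range_iff_exists_finsupp).1 hmem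
  suffices h : c = 0 by rw [h, Finsupp.sum_zero_index]
  ext ⟨i, m, n⟩
  -- P collects the terms that contribute to the matrix coefficient from e_{k,0} to e_{k-i,m-n}. For
  -- k ≥ i this coefficient is P(q^k) times a nonzero scalar, so P has infinitely many roots.
  let P : Polynomial ℂ := ∑ p ∈ c.support.filter fun p =>
    p.1 = i ∧ (p.2.1 : ℤ) - p.2.2 = m - n, Polynomial.monomial (p.2.1 + p.2.2) (c p)
  have hP : P = 0 := by
    refine Polynomial.eq_zero_of_infinite_isRoot P (Set.Infinite.mono (s :=
      (fun k : ℕ => qc q ^ k) '' Set.Ici i.toNat) ?_ ?_)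
    · rintro _ ⟨k, hk, rfl⟩
      have hk' : i ≤ k := Int.toNat_le.1 hk
      have h1 := congrArg (fun T : HSp →L[ℂ] HSp => inner ℂ (ev (k - i).toNat (m - n))
        (T (ev k 0))) hx
      simp only [Finsupp.sum, map_sum, map_smul, zero_apply, inner_zero_right,
        sum_apply, smul_apply, inner_sum, inner_smul_right] at h1
      obtain ⟨z, hz1, hz2, -, -⟩ := op_nmon q i k
      have h2 : ∀ p ∈ c.support, c p * inner ℂ (ev (k - i).toNat (m - n))
          (opHom q (nmon q p.1 p.2.1 p.2.2) (ev k 0)) =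
          if p.1 = i ∧ (p.2.1 : ℤ) - p.2.2 = m - n then
            z * (c p * (qc q ^ k) ^ (p.2.1 + p.2.2)) else 0 := by
        rintro ⟨i', m', n'⟩ -
        simp only
        by_cases hi : i' = i
        · subst hi
          rw [hz1, inner_ebasis, lp.coeFn_smul, Pi.smul_apply, ebasis_apply]
          by_cases h : (m' : ℤ) - n' = m - n
          · simp [h]; ring
          · simp [h, Ne.symm h]
        · obtain ⟨w, hw1, -, hw2, -⟩ := op_nmon q i' k
          rw [hw1, inner_ebasis, lp.coeFn_smul, Pi.smul_apply, ebasis_apply,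
            if_neg (c := i' = i ∧ _) (by tauto)]
          by_cases hk : i' ≤ k
          · rw [if_neg]
            · simp
            · simp only [Prod.mk.injEq]; omega
          · rw [hw2 (by omega)]; simp
      rw [Finset.sum_congr rfl h2, ← Finset.sum_filter, ← Finset.mul_sum] at h1
      have h3 := (mul_eq_zero.1 h1).resolve_left (hz2 hk')
      simp only [Set.mem_ofPred_eq, Polynomial.IsRoot.def, P, Polynomial.eval_finsetSum,
        Polynomial.eval_monomial]
      exact h3
    · refine Set.Infinite.image (Function.Injective.injOn ?_) (Set.Ici_infinite _)
      intro k l h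
      have h' : ((q : ℝ) ^ k) = (q : ℝ) ^ l := by
        simp only [qc] at h; exact_mod_cast h
      exact pow_right_injective₀ q.2.1 q.2.2.ne h'
  -- Within P the difference of the exponents is fixed, so the degree m + n singles out one
  -- monomial.
  have h2 := congrArg (fun p => Polynomial.coeff p (m + n)) hP
  simp only [P, Polynomial.finsetSum_coeff, Polynomial.coeff_monomial, Polynomial.coeff_zero] at h2
  rw [Finset.sum_eq_single (i, m, n)] at h2
  · simpa using h2
  · rintro ⟨i', m', n'⟩ h3 h4
    simp only [Finset.mem_filter] at h3
    refine if_neg fun h5 => h4 ?_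
    simp only at h5
    ext <;> simp only <;> omega
  · intro h3
    simpa using h3

/-! ### Extension to C(SU_q(2)) and the vector states at e_{k,0} -/

/-- The representation on `ℓ²(ℕ × ℤ)`. -/
def opRep (q : Par) : Rep q where
  B := HSp →L[ℂ] HSp
  ρ := opHom q

/-- The extension to `C(SU_q(2))` of the representation on `ℓ²(ℕ × ℤ)`. -/
def opCHom (q : Par) : CSU q →⋆ₐ[ℂ] (HSp →L[ℂ] HSp) where
  toFun x := (x : ProdRep q) (opRep q)
  map_one' := rfl
  map_mul' _ _ := rfl
  map_zero' := rfl
  map_add' _ _ := rfl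
  commutes' _ := rfl
  map_star' _ := rfl

theorem opCHom_toCSU (q : Par) (x : ASU q) : opCHom q (toCSU q x) = opHom q x := rfl

theorem norm_opCHom_le (q : Par) (x : CSU q) : ‖opCHom q x‖ ≤ ‖x‖ :=
  lp.norm_apply_le_norm ENNReal.top_ne_zero (x : ProdRep q) (opRep q)

theorem toCSU_injective (q : Par) : Function.Injective (toCSU q) := by
  refine (injective_iff_map_eq_zero _).2 fun x hx => eq_zero_of_opHom_eq_zero q x ?_
  rw [← opCHom_toCSU, hx, map_zero]

theorem denseRange_toCSU (q : Par) : DenseRange (toCSU q) := by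
  intro x
  have hx : (x : ProdRep q) ∈ closure ((univRep q).range : Set (ProdRep q)) := x.2
  rw [mem_closure_iff_seq_limit] at hx ⊢
  obtain ⟨u, hu, hlim⟩ := hx
  choose v hv using hu
  refine ⟨fun n => toCSU q (v n), fun n => ⟨_, rfl⟩, ?_⟩
  rw [tendsto_subtype_rng]
  convert hlim using 2 with n
  exact hv n

/-- The vector state given by `e_{k,0}`. -/
def chi (q : Par) (k : ℕ) : CSU q →L[ℂ] ℂ :=
  LinearMap.mkContinuous
    { toFun := fun x => inner ℂ (ev k 0) (opCHom q x (ev k 0))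
      map_add' := fun x y => by rw [map_add, add_apply, inner_add_right]
      map_smul' := fun z x => by rw [map_smul, smul_apply, inner_smul_right]; rfl } 1 fun x => by
    have h : ‖ev k 0‖ = 1 := by
      rw [ev, ebasis, lp.norm_single (by norm_num), norm_one]
    refine (norm_inner_le_norm (𝕜 := ℂ) (ev k 0) (opCHom q x (ev k 0))).trans ?_
    rw [h, one_mul, one_mul]
    refine (ContinuousLinearMap.le_opNorm _ _).trans ?_
    rw [h, mul_one]
    exact norm_opCHom_le q x

theorem chi_apply (q : Par) (k : ℕ) (x : CSU q) :
    chi q k x = inner ℂ (ev k 0) (opCHom q x (ev k 0)) := rfl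

theorem norm_chi_le (q : Par) (k : ℕ) (x : CSU q) : ‖chi q k x‖ ≤ ‖x‖ := by
  simpa using (chi q k).le_of_opNorm_le (LinearMap.mkContinuous_norm_le _ zero_le_one _) x

theorem chi_nonneg (q : Par) (k : ℕ) {x : CSU q} (hx : 0 ≤ x) : 0 ≤ chi q k x := by
  obtain ⟨y, rfl⟩ := CStarAlgebra.nonneg_iff_eq_star_mul_self.1 hx
  rw [chi_apply, map_mul, map_star, mul_apply_eq_comp, ContinuousLinearMap.star_eq_adjoint,
    ContinuousLinearMap.adjoint_inner_right]
  rw [inner_self_eq_norm_sq_to_K, ← RCLike.ofReal_pow]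
  exact Complex.zero_le_real.2 (sq_nonneg _)

/-- A diagonal matrix entry sees only monomials of torus weight zero, which are the powers of cc*.
-/
theorem chi_nmon (q : Par) (k : ℕ) (i : ℤ) (m n : ℕ) :
    chi q k (toCSU q (nmon q i m n)) = if i = 0 ∧ m = n then (qc q ^ k) ^ (m + n) else 0 := by
  rw [chi_apply, opCHom_toCSU]
  obtain ⟨z, h1, -, h2, h3⟩ := op_nmon q i k
  rw [h1, inner_ebasis, lp.coeFn_smul, Pi.smul_apply, ebasis_apply]
  by_cases hi : i = 0
  · subst hi
    by_cases hm : m = n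
    · simp [hm, h3]
    · have : ¬ (0 = (m : ℤ) - n) := by omega
      simp [hm, this]
  · by_cases hk : i ≤ k
    · have : ¬ (k = (k - i).toNat) := by omega
      simp [hi, this]
    · rw [h2 (by omega)]; simp [hi]

/-! ### The Haar state -/

theorem exists_circle_zpow_ne_one {n : ℤ} (hn : n ≠ 0) : ∃ u : Circle, u ^ n ≠ 1 := by
  refine ⟨Circle.exp (Real.pi / n), ?_⟩
  have hn' : (n : ℝ) ≠ 0 := by exact_mod_cast hn
  intro h
  rw [← Circle.exp_zsmul, zsmul_eq_mul, mul_div_cancel₀ _ hn'] at h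
  have := congrArg (fun z : Circle => (z : ℂ)) h
  simp only [Circle.coe_exp, Complex.exp_pi_mul_I, Circle.coe_one] at this
  norm_num at this

/-- The weight `(1 - q²) q^{2k}` of the vector `e_{k,0}` in the Haar state. -/
def hwt (q : Par) (k : ℕ) : ℝ := (1 - (q : ℝ) ^ 2) * ((q : ℝ) ^ 2) ^ k

theorem hwt_pos (q : Par) (k : ℕ) : 0 < hwt q k :=
  mul_pos (one_sub_pow_pos q two_ne_zero) (pow_pos (pow_pos q.2.1 _) _)

theorem hasSum_hwt (q : Par) (n : ℕ) : HasSum (fun k => (hwt q k : ℂ) * (qc q ^ k) ^ (n + n))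
    ((1 - qc q ^ 2) / (1 - qc q ^ (2 * n + 2))) := by
  have h : ‖qc q ^ (2 * n + 2)‖ < 1 := by
    rw [norm_pow, norm_qc]; exact pow_lt_one₀ q.2.1.le q.2.2 (by omega)
  have := (hasSum_geometric_of_norm_lt_one h).mul_left (1 - qc q ^ 2)
  rw [← div_eq_mul_inv] at this
  have h' : (fun k => (hwt q k : ℂ) * (qc q ^ k) ^ (n + n)) =
      fun k => (1 - qc q ^ 2) * (qc q ^ (2 * n + 2)) ^ k := by
    funext k
    rw [hwt, qc]
    push_cast
    ring
  rw [h']; exact this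

theorem summable_hwt_chi (q : Par) (x : CSU q) :
    Summable fun k => (hwt q k : ℂ) * chi q k x := by
  have h : Summable fun k => hwt q k * ‖x‖ :=
    ((summable_geometric_of_lt_one (sq_nonneg _)
      (pow_lt_one₀ q.2.1.le q.2.2 two_ne_zero)).mul_left _).mul_right _
  refine Summable.of_norm_bounded h fun k => ?_
  rw [norm_mul, Complex.norm_real, Real.norm_of_nonneg (hwt_pos q k).le]
  exact mul_le_mul_of_nonneg_left (norm_chi_le q k x) (hwt_pos q k).le

/-- The Haar state `x ↦ (1 - q²) ∑_k q^{2k} ⟨e_{k,0}, x e_{k,0}⟩`. -/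
def haarSum (q : Par) : CSU q →ₚ[ℂ] ℂ :=
  PositiveLinearMap.mk₀
    { toFun := fun x => ∑' k, (hwt q k : ℂ) * chi q k x
      map_add' := fun x y => by
        simp only [map_add, mul_add]
        exact (summable_hwt_chi q x).tsum_add (summable_hwt_chi q y)
      map_smul' := fun z x => by
        simp only [map_smul, smul_eq_mul, mul_left_comm, tsum_mul_left, RingHom.id_apply] }
    fun x hx => tsum_nonneg fun k =>
      mul_nonneg (Complex.zero_le_real.2 (hwt_pos q k).le) (chi_nonneg q k hx)

theorem hasSum_haarSum (q : Par) (x : CSU q) :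
    HasSum (fun k => (hwt q k : ℂ) * chi q k x) (haarSum q x) :=
  (summable_hwt_chi q x).hasSum

theorem haarSum_nmon (q : Par) (i : ℤ) (m n : ℕ) : haarSum q (toCSU q (nmon q i m n)) =
    if i = 0 ∧ m = n then (1 - qc q ^ 2) / (1 - qc q ^ (2 * n + 2)) else 0 := by
  refine (hasSum_haarSum q _).unique ?_
  simp only [chi_nmon]
  split_ifs with h
  · rw [h.2]; exact hasSum_hwt q n
  · simp

theorem chi_tau (q : Par) (k : ℕ) (g : Circle × Circle) (x : ASU q) :
    chi q k (toCSU q (tau q g x)) = chi q k (toCSU q x) := by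
  induction x using nmon_induction with
  | nmon i m n =>
    rw [tau_nmon, map_smul, map_smul, chi_nmon]
    split_ifs with h
    · simp [h.1, h.2]
    · simp
  | zero => simp
  | add x y hx hy => simp only [map_add, hx, hy]
  | smul z x hx => simp only [map_smul, hx]

theorem haarSum_tau (q : Par) (g : Circle × Circle) (x : ASU q) :
    haarSum q (toCSU q (tau q g x)) = haarSum q (toCSU q x) := by
  refine (hasSum_haarSum q _).unique ?_
  simpa only [chi_tau] using hasSum_haarSum q (toCSU q x)

theorem nmon_zero (q : Par) (m n : ℕ) : nmon q 0 m n = gc q ^ m * gcs q ^ n := by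
  rw [nmon, show apow q 0 = 1 from pow_zero (ga q), one_mul]

/-- These are the only normally ordered monomials whose image under E has torus weight zero, hence
the only ones for which h(E ▷ x) = 0 needs a computation. -/
theorem actE_nmon_one (q : Par) (n : ℕ) : actE q (nmon q 1 (n + 1) n) =
    ((sqr q : ℂ) ^ (n + 1) * cCoef q n) • (nmon q 0 n n - qc q ^ 2 • nmon q 0 (n + 1) (n + 1)) -
      (sqr q : ℂ) • nmon q 0 (n + 1) (n + 1) := by
  have hs := sqr_ne_zero q
  have h1 := (actKe_neg_one_pow q 1).1
  have hcn : gcs q * gc q ^ (n + 1) = gc q ^ (n + 1) * gcs q :=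
    ((commute_c_cs q).symm.pow_right _).eq
  have h2 : ga q * (gas q * gc q ^ n) = gc q ^ n - qc q ^ 2 • (gc q ^ (n + 1) * gcs q) := by
    rw [← mul_assoc, a_mul_as, sub_mul, one_mul, smul_mul_assoc, mul_assoc,
      ((commute_c_cs q).symm.pow_right n).eq, ← mul_assoc, pow_succ' (gc q)]
  rw [pow_one, pow_one] at h1
  rw [nmon, show apow q 1 = ga q from pow_one (ga q), nmon_zero, nmon_zero, ← mul_assoc, actE_mul,
    actE_gcs_pow, mul_zero, add_zero, actE_mul, actE_ga, actE_gc_pow, h1,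
    (actKe_one_pow q n).2.2, (actKe_one_pow q _).2.1, smul_mul_smul_comm, smul_mul_smul_comm, hcn,
    h2, pow_succ' (gcs q)]
  simp only [smul_sub, add_mul, sub_mul, smul_mul_assoc, mul_smul_comm, mul_assoc]
  match_scalars
  · have h3 : (sqr q : ℂ) ^ n * (sqr q : ℂ)⁻¹ ^ n = 1 := by
      rw [← mul_pow, mul_inv_cancel₀ hs, one_pow]
    rw [qc_eq_sq]
    linear_combination (-(sqr q : ℂ) * (sqr q * (sqr q : ℂ)⁻¹)) * h3 -
      (sqr q : ℂ) * mul_inv_cancel₀ hs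
  · ring

/-- Torus invariance disposes of all monomials except a c^{n+1} (c*)^n. For these the moments (1 -
q²)/(1 - q^{2n+2}) of cc* make the terms cancel. -/
theorem haarSum_actE (q : Par) (x : ASU q) : haarSum q (toCSU q (actE q x)) = 0 := by
  induction x using nmon_induction with
  | nmon i m n =>
    have key : ∀ g : Circle × Circle, ((g.1 ^ (i - 1) * g.2 ^ ((m : ℤ) - n - 1) : Circle) : ℂ) *
        haarSum q (toCSU q (actE q (nmon q i m n))) =
        haarSum q (toCSU q (actE q (nmon q i m n))) := by
      intro g
      have h := congrArg (fun x => haarSum q (toCSU q x)) (actE_tau q g (nmon q i m n))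
      simp only [tau_nmon, map_smul, haarSum_tau, smul_eq_mul] at h
      refine mul_left_cancel₀ (Circle.coe_ne_zero (g.1 * g.2)) ?_
      rw [← h, ← mul_assoc, ← Circle.coe_mul]
      congr 2
      rw [zpow_sub_one, zpow_sub_one, mul_mul_mul_comm, mul_comm g.1, mul_comm g.2,
        inv_mul_cancel_right, inv_mul_cancel_right]
    by_cases hi : i = 1
    · by_cases hm : (m : ℤ) - n - 1 = 0
      · obtain rfl : m = n + 1 := by omega
        subst hi
        rw [actE_nmon_one]
        simp only [map_sub, map_smul, haarSum_nmon, smul_eq_mul, and_self, if_true]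
        have hg := geom_sum_mul (qc q ^ 2) (n + 1)
        have ht : ∀ k : ℕ, k ≠ 0 → 1 - qc q ^ k ≠ 0 := fun k hk => by
          have := (one_sub_pow_pos q hk).ne'
          rw [qc]; exact_mod_cast this
        have h4 : (sqr q : ℂ) ^ 4 = qc q ^ 2 := by rw [qc_eq_sq]; ring
        have h1 := ht 2 two_ne_zero
        have h2 := ht (2 * n + 2) (by omega)
        have h3 := ht (2 * (n + 1) + 2) (by omega)
        have hs := sqr_ne_zero q
        -- The geometric sum in `cCoef` is the reciprocal of the n-th moment of cc*.
        have hc : (cCoef q n : ℂ) = (sqr q : ℂ)⁻¹ ^ n *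
            ((1 - qc q ^ (2 * n + 2)) / (1 - qc q ^ 2)) := by
          rw [cCoef]; push_cast
          rw [h4]; congr 1
          rw [eq_div_iff h1]; linear_combination -hg
        rw [hc, inv_pow]
        field_simp
        ring
      · obtain ⟨u, hu⟩ := exists_circle_zpow_ne_one hm
        refine (mul_left_eq_self₀.1 (key (1, u))).resolve_left fun h => hu ?_
        simpa using Circle.ext (h.trans Circle.coe_one.symm)
    · obtain ⟨u, hu⟩ := exists_circle_zpow_ne_one (sub_ne_zero.2 hi)
      refine (mul_left_eq_self₀.1 (key (u, 1))).resolve_left fun h => hu ?_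
      simpa using Circle.ext (h.trans Circle.coe_one.symm)
  | zero => simp
  | add x y hx hy => simp only [map_add, hx, hy, add_zero]
  | smul z x hx => simp only [map_smul, hx, smul_zero]

/-- For n > -l the element t^l_{mn} lies in the range of E. For n = -l it is a multiple of a^{l-m}
c^{l+m}, which has nonzero torus weight when l > 0. -/
theorem isHaar_haarSum (q : Par) : IsHaar q (haarSum q) := by
  refine ⟨?_, fun i hi => ?_⟩
  · have h := haarSum_nmon q 0 0 0
    rw [nmon_zero, pow_zero, pow_zero, mul_one, map_one, if_pos ⟨rfl, rfl⟩] at h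
    rw [h]
    refine div_self ?_
    have := (one_sub_pow_pos q two_ne_zero).ne'
    rw [qc]; exact_mod_cast this
  · obtain ⟨z, -, h⟩ := matEl_eq q i
    obtain ⟨d, j, k, hk⟩ := i
    rw [h, map_smul, map_smul]
    have hd : 0 < d := by
      by_contra h0
      obtain rfl : d = 0 := by omega
      simp [Lab.l] at hi
    cases k with
    | zero =>
      have h2 := haarSum_nmon q ((d - (j : ℕ) : ℕ) : ℤ) j 0
      rw [if_neg (by have := j.2; omega), nmon, apow_natCast, pow_zero, mul_one] at h2
      simp only [pow_zero, Module.End.one_apply]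
      rw [h2, smul_zero]
    | succ k =>
      simp only [pow_succ', Module.End.mul_apply]
      rw [haarSum_actE, smul_zero]

theorem continuous_positive {q : Par} (h : CSU q →ₚ[ℂ] ℂ) : Continuous h := by
  obtain ⟨C, hC⟩ := PositiveLinearMap.exists_norm_apply_le h
  exact AddMonoidHomClass.continuous_of_bound h C hC

/-- The value on every matrix element is prescribed, since those of spin 0 are scalars. Spanning,
density and automatic continuity of positive functionals do the rest. -/
theorem IsHaar.eq {q : Par} {h h' : CSU q →ₚ[ℂ] ℂ} (hh : IsHaar q h) (hh' : IsHaar q h') :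
    h = h' := by
  have key : ∀ x : ASU q, h (toCSU q x) = h' (toCSU q x) := by
    intro x
    have hx : x ∈ Submodule.span ℂ (Set.range (matEl q)) := span_matEl q ▸ Submodule.mem_top
    induction hx using Submodule.span_induction with
    | mem x hx =>
      obtain ⟨⟨d, j, k⟩, rfl⟩ := hx
      rcases Nat.eq_zero_or_pos d with rfl | hd
      · obtain ⟨z, -, h⟩ := matEl_eq q ⟨0, j, k⟩
        have hj : (j : ℕ) = 0 := by omega
        have hk : (k : ℕ) = 0 := by omega
        simp only [hj, hk, pow_zero, mul_one, Module.End.one_apply, Nat.sub_zero] at h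
        rw [h, map_smul, map_one, map_smul, map_smul, hh.1, hh'.1]
      · have : 0 < Lab.l ⟨d, j, k⟩ := by simp only [Lab.l]; positivity
        rw [hh.2 _ this, hh'.2 _ this]
    | zero => simp
    | add x y _ _ hx hy => simp only [map_add, hx, hy]
    | smul z x _ hx => simp only [map_smul, hx]
  refine DFunLike.coe_injective ?_
  exact (denseRange_toCSU q).equalizer (continuous_positive h) (continuous_positive h')
    (funext key)

theorem isHaar_haar (q : Par) : IsHaar q (haar q) := Classical.epsilon_spec ⟨_, isHaar_haarSum q⟩

theorem haar_eq (q : Par) : haar q = haarSum q := (isHaar_haar q).eq (isHaar_haarSum q)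

theorem haar_actF (q : Par) (x : ASU q) : haar q (toCSU q (actF q x)) = 0 := by
  have h := haarSum_actE q (star x)
  rw [← haar_eq, ← star_eq_zero, ← map_star, ← map_star, star_actE, star_star, map_smul, map_smul,
    smul_eq_zero] at h
  exact h.resolve_left (neg_ne_zero.2 (qc_ne_zero q))

/-! ### Averages of positive elements -/

open MeasureTheory in
/-- A continuous nonnegative function with values in a `C*`-algebra vanishes if its integral does. -/
theorem eq_zero_of_integral_eq_zero {G : Type*} [TopologicalSpace G] [CompactSpace G]
    [MeasurableSpace G] [BorelSpace G] (μ : Measure G) [IsFiniteMeasure μ] [μ.IsOpenPosMeasure]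
    {B : Type*} [CStarAlgebra B] [PartialOrder B] [StarOrderedRing B] {f : G → B}
    (hf : Continuous f) (h0 : ∀ g, 0 ≤ f g) (hI : ∫ g, f g ∂μ = 0) (g : G) : f g = 0 := by
  have hint : Integrable f μ :=
    hf.integrable_of_hasCompactSupport (HasCompactSupport.of_compactSpace f)
  refine norm_le_zero_iff.1 (le_of_forall_pos_le_add fun ε hε => ?_)
  rw [zero_add]
  set U : Set G := {y | ‖f y - f g‖ < ε} with hU
  have hUo : IsOpen U := isOpen_lt (by fun_prop) continuous_const
  have hUpos : 0 < μ.real U :=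
    ENNReal.toReal_pos (hUo.measure_pos μ ⟨g, by simpa [hU] using hε⟩).ne' (measure_ne_top _ _)
  -- On U the self-adjoint element f g - f y has norm below ε. Integrating the bound over U gives
  -- μ(U)(f g - ε) ≤ ∫ f = 0, hence 0 ≤ f g ≤ ε.
  have hle : ∀ y ∈ U, f g - algebraMap ℝ B ε ≤ f y := by
    intro y hy
    have hsa : IsSelfAdjoint (f g - f y) := (IsSelfAdjoint.of_nonneg (h0 g)).sub (.of_nonneg (h0 y))
    have h1 := hsa.le_algebraMap_norm_self
    have h2 : algebraMap ℝ B ‖f g - f y‖ ≤ algebraMap ℝ B ε := by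
      refine algebraMap_mono _ ?_
      rw [norm_sub_rev]
      exact le_of_lt hy
    have h3 := h1.trans h2
    rw [sub_le_iff_le_add] at h3 ⊢
    rwa [add_comm]
  have h1 : μ.real U • (f g - algebraMap ℝ B ε) ≤ 0 := by
    rw [← setIntegral_const, ← hI, ← setIntegral_univ (μ := μ)]
    refine (setIntegral_mono_on (integrable_const _).integrableOn hint.integrableOn
      hUo.measurableSet hle).trans ?_
    exact setIntegral_mono_set hint.integrableOn (ae_of_all _ h0) (ae_of_all _ fun x _ => trivial)
  have h2 : f g - algebraMap ℝ B ε ≤ 0 := by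
    have := smul_le_smul_of_nonneg_left h1 (inv_nonneg.2 hUpos.le)
    rwa [smul_zero, inv_smul_smul₀ hUpos.ne'] at this
  rw [sub_nonpos] at h2
  have h3 := CStarAlgebra.norm_le_norm_of_nonneg_of_le (h0 g) h2
  refine h3.trans ?_
  rcases subsingleton_or_nontrivial B with h | h
  · rw [Subsingleton.elim (algebraMap ℝ B ε) 0, norm_zero]; exact hε.le
  · rw [norm_algebraMap', Real.norm_of_nonneg hε.le]

/-! ### The torus action on `C(SU_q(2))` -/

/-- The representation `ρ ∘ φ`. -/
def Rep.pull {q : Par} (φ : ASU q →⋆ₐ[ℂ] ASU q) (r : Rep q) : Rep q where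
  B := r.B
  ρ := r.ρ.comp φ

/-- The `*`-endomorphism of the product given by `(x_ρ)_ρ ↦ (x_{ρ ∘ φ})_ρ`. -/
def prodMap {q : Par} (φ : ASU q →⋆ₐ[ℂ] ASU q) : ProdRep q →⋆ₐ[ℂ] ProdRep q where
  toFun x := ⟨fun r => x (r.pull φ), by
    refine memℓp_infty ⟨‖x‖, ?_⟩
    rintro _ ⟨r, rfl⟩
    exact lp.norm_apply_le_norm ENNReal.top_ne_zero x (r.pull φ)⟩
  map_one' := rfl
  map_mul' x y := rfl
  map_zero' := rfl
  map_add' x y := rfl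
  commutes' z := rfl
  map_star' x := rfl

theorem norm_prodMap_le {q : Par} (φ : ASU q →⋆ₐ[ℂ] ASU q) (x : ProdRep q) :
    ‖prodMap φ x‖ ≤ ‖x‖ :=
  lp.norm_le_of_forall_le (norm_nonneg x) fun r =>
    lp.norm_apply_le_norm ENNReal.top_ne_zero x (r.pull φ)

theorem prodMap_mem {q : Par} (φ : ASU q →⋆ₐ[ℂ] ASU q) (x : ProdRep q) (hx : x ∈ CSUsub q) :
    prodMap φ x ∈ CSUsub q := by
  have hc : Continuous (prodMap φ) :=
    AddMonoidHomClass.continuous_of_bound (prodMap φ) 1 fun x => by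
      rw [one_mul]; exact norm_prodMap_le φ x
  refine map_mem_closure (s := ((univRep q).range : Set (ProdRep q))) hc hx ?_
  rintro _ ⟨y, rfl⟩
  exact ⟨φ y, rfl⟩

/-- The `*`-endomorphism of `C(SU_q(2))` extending a `*`-endomorphism of `A(SU_q(2))`. -/
def mapC {q : Par} (φ : ASU q →⋆ₐ[ℂ] ASU q) : CSU q →⋆ₐ[ℂ] CSU q :=
  ((prodMap φ).comp (CSUsub q).subtype).codRestrict (CSUsub q) fun x => prodMap_mem φ x x.2

theorem mapC_toCSU {q : Par} (φ : ASU q →⋆ₐ[ℂ] ASU q) (x : ASU q) :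
    mapC φ (toCSU q x) = toCSU q (φ x) := rfl

theorem norm_mapC_le {q : Par} (φ : ASU q →⋆ₐ[ℂ] ASU q) (x : CSU q) : ‖mapC φ x‖ ≤ ‖x‖ :=
  norm_prodMap_le φ x

theorem continuous_mapC {q : Par} (φ : ASU q →⋆ₐ[ℂ] ASU q) : Continuous (mapC φ) :=
  AddMonoidHomClass.continuous_of_bound (mapC φ) 1 fun x => by
    rw [one_mul]; exact norm_mapC_le φ x

theorem alphaC_eq (q : Par) (u : Circle) : alphaC q u = mapC (alpha q u) := rfl

/-- On polynomials the torus acts by explicit continuous weights. All the maps are contractions, so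
polynomial approximation of x is uniform in g. -/
theorem continuous_tauC_apply (q : Par) (x : CSU q) :
    Continuous fun g : Circle × Circle => mapC (tau q g) x := by
  have hpol : ∀ y : ASU q, Continuous fun g : Circle × Circle => mapC (tau q g) (toCSU q y) := by
    intro y
    simp only [mapC_toCSU]
    induction y using nmon_induction with
    | nmon i m n =>
      simp only [tau_nmon, map_smul]
      refine Continuous.smul (Continuous.comp (g := fun u : Circle => (u : ℂ)) (by fun_prop) ?_) continuous_const
      exact (continuous_fst.zpow i).mul (continuous_snd.zpow _)
    | zero => simpa using continuous_const
    | add x y hx hy => simp only [map_add]; exact hx.add hy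
    | smul z x hx => simp only [map_smul]; exact hx.const_smul z
  refine continuous_of_uniform_approx_of_continuous fun u hu => ?_
  obtain ⟨ε, hε, hu⟩ := Metric.mem_uniformity_dist.1 hu
  obtain ⟨y, hy⟩ := (denseRange_toCSU q).exists_dist_lt x hε
  refine ⟨_, hpol y, fun g => hu ?_⟩
  rw [dist_eq_norm, ← map_sub]
  exact (norm_mapC_le _ _).trans_lt (by rwa [← dist_eq_norm])

theorem chi_tauC (q : Par) (k : ℕ) (g : Circle × Circle) (x : CSU q) :
    chi q k (mapC (tau q g) x) = chi q k x :=
  congrFun ((denseRange_toCSU q).equalizer ((chi q k).continuous.comp (continuous_mapC _))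
    (chi q k).continuous (funext fun y => chi_tau q k g y)) x

/-- The Borel `σ`-algebra of the torus. -/
local instance torusMeasurableSpace : MeasurableSpace (Circle × Circle) := borel _
local instance torusBorelSpace : BorelSpace (Circle × Circle) := ⟨rfl⟩

/-- The normalized Haar measure of the torus. -/
def torusMeasure : MeasureTheory.Measure (Circle × Circle) := MeasureTheory.Measure.haarMeasure ⊤

local instance : MeasureTheory.IsProbabilityMeasure torusMeasure :=
  ⟨MeasureTheory.Measure.haarMeasure_self⟩
local instance : torusMeasure.IsHaarMeasure :=
  inferInstanceAs (MeasureTheory.Measure.IsHaarMeasure (MeasureTheory.Measure.haarMeasure ⊤))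

theorem integrable_tauC (q : Par) (x : CSU q) :
    MeasureTheory.Integrable (fun g => mapC (tau q g) x) torusMeasure :=
  (continuous_tauC_apply q x).integrable_of_hasCompactSupport (HasCompactSupport.of_compactSpace _)

/-- The average over the torus action. -/
def avg (q : Par) : CSU q →L[ℂ] CSU q :=
  LinearMap.mkContinuous
    { toFun := fun x => ∫ g, mapC (tau q g) x ∂torusMeasure
      map_add' := fun x y => by
        simp only [map_add]
        exact MeasureTheory.integral_add (integrable_tauC q x) (integrable_tauC q y)
      map_smul' := fun z x => by
        simp only [map_smul]
        exact MeasureTheory.integral_smul z _ } 1 fun x => by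
    have h := MeasureTheory.norm_integral_le_of_norm_le_const (μ := torusMeasure)
      (Filter.Eventually.of_forall fun g => norm_mapC_le (tau q g) x)
    rwa [MeasureTheory.probReal_univ, mul_comm] at h

theorem avg_apply (q : Par) (x : CSU q) : avg q x = ∫ g, mapC (tau q g) x ∂torusMeasure := rfl

theorem chi_avg (q : Par) (k : ℕ) (x : CSU q) : chi q k (avg q x) = chi q k x := by
  rw [avg_apply, ← ContinuousLinearMap.integral_comp_comm _ (integrable_tauC q x)]
  simp [chi_tauC]

/-- The average integrates a continuous function with positive values, so that function vanishes
everywhere, in particular at the identity of the torus, where its value is x. -/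
theorem eq_zero_of_avg_eq_zero (q : Par) {x : CSU q} (hx : 0 ≤ x) (h : avg q x = 0) : x = 0 := by
  have h1 := eq_zero_of_integral_eq_zero torusMeasure (continuous_tauC_apply q x)
    (fun g => by
      obtain ⟨y, rfl⟩ := CStarAlgebra.nonneg_iff_eq_star_mul_self.1 hx
      rw [map_mul, map_star]
      exact star_mul_self_nonneg _) h 1
  have h2 : mapC (tau q 1) x = x := by
    refine congrFun ((denseRange_toCSU q).equalizer (continuous_mapC _) continuous_id
      (funext fun y => ?_)) x
    change toCSU q (tau q 1 y) = toCSU q y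
    congr 1
    induction y using nmon_induction with
    | nmon i m n => rw [tau_nmon]; simp
    | zero => simp
    | add x y hx hy => rw [map_add, hx, hy]
    | smul z x hx => rw [map_smul, hx]
  rw [← h2, h1]

/-- By translation invariance of the measure, the average is fixed under multiplication by the
weight character. So it vanishes unless the weight is trivial. -/
theorem avg_nmon (q : Par) (i : ℤ) (m n : ℕ) : avg q (toCSU q (nmon q i m n)) =
    if i = 0 ∧ m = n then toCSU q (nmon q i m n) else 0 := by
  have hinv : ∀ g : Circle × Circle, ((g.1 ^ i * g.2 ^ ((m : ℤ) - n) : Circle) : ℂ) •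
      avg q (toCSU q (nmon q i m n)) = avg q (toCSU q (nmon q i m n)) := by
    intro g
    conv_rhs => rw [avg_apply, ← MeasureTheory.integral_mul_left_eq_self _ g]
    rw [avg_apply, ← MeasureTheory.integral_smul]
    congr 1; funext g'
    rw [mapC_toCSU, mapC_toCSU, tau_nmon, tau_nmon, map_smul, map_smul, smul_smul, ← Circle.coe_mul]
    congr 2
    rw [Prod.fst_mul, Prod.snd_mul, mul_zpow, mul_zpow, mul_mul_mul_comm]
  have hz : ∀ u : Circle, u ≠ 1 → (u : ℂ) • avg q (toCSU q (nmon q i m n)) =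
      avg q (toCSU q (nmon q i m n)) → avg q (toCSU q (nmon q i m n)) = 0 := by
    intro u hu h
    have h' : ((u : ℂ) - 1) • avg q (toCSU q (nmon q i m n)) = 0 := by
      rw [sub_smul, h, one_smul, sub_self]
    exact (smul_eq_zero.1 h').resolve_left fun h => hu (Circle.ext (by simpa using sub_eq_zero.1 h))
  by_cases hi : i = 0
  · by_cases hm : m = n
    · rw [if_pos ⟨hi, hm⟩, avg_apply]
      subst hi hm
      simp [mapC_toCSU, tau_nmon]
    · rw [if_neg (by tauto)]
      obtain ⟨u, hu⟩ := exists_circle_zpow_ne_one (n := (m : ℤ) - n) (by omega)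
      exact hz _ hu (by simpa using hinv (1, u))
  · rw [if_neg (by tauto)]
    obtain ⟨u, hu⟩ := exists_circle_zpow_ne_one hi
    exact hz _ hu (by simpa using hinv (u, 1))

/-! ### The spectrum of `c c*` and faithfulness of the Haar state -/

/-- The element `c c*` of `C(SU_q(2))`. -/
def ccs (q : Par) : CSU q := toCSU q (gc q * gcs q)

theorem isSelfAdjoint_ccs (q : Par) : IsSelfAdjoint (ccs q) := by
  rw [IsSelfAdjoint, ccs, ← map_star, star_mul, star_gcs, star_gc]

theorem toCSU_nmon_eq (q : Par) (n : ℕ) : toCSU q (nmon q 0 n n) = ccs q ^ n := by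
  rw [nmon_zero, ← (commute_c_cs q).mul_pow, map_pow]; rfl

/-- The elements a*a = 1 - cc* and aa* = 1 - q²cc* have the same nonzero spectrum. -/
theorem spectrum_ccs_step (q : Par) {z : ℂ} (hz : z ∈ spectrum ℂ (ccs q)) (h1 : z ≠ 1) :
    z / qc q ^ 2 ∈ spectrum ℂ (ccs q) := by
  have hq : qc q ^ 2 ≠ 0 := pow_ne_zero _ (qc_ne_zero q)
  have ha : toCSU q (gas q) * toCSU q (ga q) = 1 - ccs q := by
    rw [← map_mul, as_mul_a, map_sub, map_one]; rfl
  have ha' : toCSU q (ga q) * toCSU q (gas q) = 1 - qc q ^ 2 • ccs q := by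
    rw [← map_mul, a_mul_as, map_sub, map_one, map_smul]; rfl
  have h2 : 1 - z ∈ spectrum ℂ (1 - ccs q) := by
    rw [spectrum.mem_iff] at hz ⊢
    have : algebraMap ℂ (CSU q) (1 - z) - (1 - ccs q) = -(algebraMap ℂ _ z - ccs q) := by
      rw [map_sub, map_one]; abel
    rwa [this, IsUnit.neg_iff]
  have h3 : 1 - z ∈ spectrum ℂ (1 - qc q ^ 2 • ccs q) := by
    have : 1 - z ∈ spectrum ℂ (toCSU q (gas q) * toCSU q (ga q)) \ {0} := by
      rw [ha]; exact ⟨h2, fun h => h1 (sub_eq_zero.1 h).symm⟩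
    rw [spectrum.nonzero_mul_comm, ha'] at this
    exact this.1
  rw [spectrum.mem_iff] at h3 ⊢
  have : algebraMap ℂ (CSU q) (1 - z) - (1 - qc q ^ 2 • ccs q) =
      -(qc q ^ 2 • (algebraMap ℂ _ (z / qc q ^ 2) - ccs q)) := by
    rw [smul_sub, Algebra.smul_def (qc q ^ 2) (algebraMap ℂ (CSU q) _), ← map_mul,
      mul_div_cancel₀ _ hq, map_sub, map_one]; abel
  rw [this, IsUnit.neg_iff] at h3
  exact fun h => h3 (h.smul (Units.mk0 _ hq))

/-- Repeated division of z ≠ 0 by q² would leave the bounded spectrum, unless the process stops at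
1. -/
theorem spectrum_ccs (q : Par) {z : ℂ} (hz : z ∈ spectrum ℂ (ccs q)) :
    z = 0 ∨ ∃ k : ℕ, z = (qc q ^ 2) ^ k := by
  by_contra! hcon
  have hq : qc q ^ 2 ≠ 0 := pow_ne_zero _ (qc_ne_zero q)
  have h : ∀ k : ℕ, z / (qc q ^ 2) ^ k ∈ spectrum ℂ (ccs q) := by
    intro k
    induction k with
    | zero => simpa using hz
    | succ k ih =>
      have := spectrum_ccs_step q ih fun h =>
        hcon.2 k (by rwa [div_eq_one_iff_eq (pow_ne_zero _ hq)] at h)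
      rwa [div_div, ← pow_succ] at this
  have hz0 : 0 < ‖z‖ := norm_pos_iff.2 hcon.1
  obtain ⟨C, hC⟩ : ∃ C : ℝ, ∀ w ∈ spectrum ℂ (ccs q), ‖w‖ ≤ C :=
    ⟨_, fun w hw => spectrum.norm_le_norm_mul_of_mem hw⟩
  have hC0 : 0 < C := hz0.trans_le (hC z hz)
  have hq2 : ‖qc q ^ 2‖ < 1 := by
    rw [norm_pow, norm_qc]; exact pow_lt_one₀ q.2.1.le q.2.2 two_ne_zero
  obtain ⟨k, hk⟩ := exists_pow_lt_of_lt_one (div_pos hz0 hC0) hq2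
  have h1 := hC _ (h k)
  rw [norm_div, norm_pow, div_le_iff₀ (pow_pos (norm_pos_iff.2 hq) _)] at h1
  rw [lt_div_iff₀ hC0] at hk
  linarith

theorem chi_aeval (q : Par) (k : ℕ) (p : Polynomial ℂ) :
    chi q k (Polynomial.aeval (ccs q) p) = p.eval ((qc q ^ 2) ^ k) := by
  induction p using Polynomial.induction_on' with
  | add p r hp hr => simp only [map_add, hp, hr, Polynomial.eval_add]
  | monomial n z =>
    rw [Polynomial.aeval_monomial, ← Algebra.smul_def, map_smul, ← toCSU_nmon_eq, chi_nmon,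
      if_pos ⟨rfl, rfl⟩, Polynomial.eval_monomial, smul_eq_mul]
    ring

/-- The functional calculus bounds the norm by the values of p on the spectrum. The value at q^{2k}
is given by `chi_aeval`, and the value at 0 is their limit. -/
theorem norm_aeval_le (q : Par) (p : Polynomial ℂ) {M : ℝ}
    (h : ∀ k, ‖chi q k (Polynomial.aeval (ccs q) p)‖ ≤ M) : ‖Polynomial.aeval (ccs q) p‖ ≤ M := by
  have := (isSelfAdjoint_ccs q).isStarNormal
  simp only [chi_aeval] at h
  rw [← cfc_polynomial p (ccs q),
    norm_cfc_le_iff _ _ ((norm_nonneg _).trans (h 0)) p.continuous.continuousOn]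
  intro z hz
  rcases spectrum_ccs q hz with rfl | ⟨k, rfl⟩
  · have hq2 : ‖qc q ^ 2‖ < 1 := by
      rw [norm_pow, norm_qc]; exact pow_lt_one₀ q.2.1.le q.2.2 two_ne_zero
    have h1 := (p.continuous.tendsto 0).comp (tendsto_pow_atTop_nhds_zero_of_norm_lt_one hq2)
    exact le_of_tendsto h1.norm (Filter.Eventually.of_forall h)
  · exact h k

/-- By `avg_nmon` the average of a polynomial element is a polynomial in cc*, and the averaging map
is continuous. -/
theorem avg_mem_closure (q : Par) (x : CSU q) :
    avg q x ∈ closure (Set.range fun p : Polynomial ℂ => Polynomial.aeval (ccs q) p) := by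
  refine map_mem_closure (avg q).continuous (denseRange_toCSU q x) ?_
  rintro _ ⟨y, rfl⟩
  induction y using nmon_induction with
  | nmon i m n =>
    rw [avg_nmon]
    split_ifs with h
    · obtain ⟨rfl, rfl⟩ := h
      exact ⟨Polynomial.X ^ m, by simp [toCSU_nmon_eq]⟩
    · exact ⟨0, map_zero _⟩
  | zero => exact ⟨0, by simp⟩
  | add x y hx hy =>
    obtain ⟨p, hp⟩ := hx
    obtain ⟨r, hr⟩ := hy
    exact ⟨p + r, by simp only [map_add] at *; rw [hp, hr]⟩
  | smul z x hx =>
    obtain ⟨p, hp⟩ := hx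
    exact ⟨z • p, by simp only [map_smul] at *; rw [hp]⟩

theorem eq_zero_of_chi_eq_zero (q : Par) {x : CSU q}
    (hx : x ∈ closure (Set.range fun p : Polynomial ℂ => Polynomial.aeval (ccs q) p))
    (h : ∀ k, chi q k x = 0) : x = 0 := by
  refine norm_le_zero_iff.1 (le_of_forall_pos_le_add fun ε hε => ?_)
  obtain ⟨_, ⟨p, rfl⟩, hp⟩ := Metric.mem_closure_iff.1 hx (ε / 2) (half_pos hε)
  rw [dist_eq_norm] at hp
  have h1 := norm_aeval_le q p (M := ε / 2) fun k => by
    have := norm_chi_le q k (x - Polynomial.aeval (ccs q) p)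
    rw [map_sub, h, zero_sub, norm_neg] at this
    exact this.trans hp.le
  have h2 := norm_le_norm_sub_add x (Polynomial.aeval (ccs q) p)
  linarith

/-- The Haar state is faithful. -/
theorem haar_faithful (q : Par) {x : CSU q} (hx : 0 ≤ x) (h : haar q x = 0) : x = 0 := by
  refine eq_zero_of_avg_eq_zero q hx (eq_zero_of_chi_eq_zero q (avg_mem_closure q x) fun k => ?_)
  rw [chi_avg]
  rw [haar_eq] at h
  have hs := hasSum_haarSum q x
  -- A vanishing sum of nonnegative terms with strictly positive weights forces every χ_k(x) to
  -- vanish.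
  have h0 : ∀ k, 0 ≤ (hwt q k : ℂ) * chi q k x := fun k =>
    mul_nonneg (Complex.zero_le_real.2 (hwt_pos q k).le) (chi_nonneg q k hx)
  rw [h, hasSum_zero_iff_of_nonneg h0] at hs
  have := congrFun hs k
  exact (mul_eq_zero.1 this).resolve_left (Complex.ofReal_ne_zero.2 (hwt_pos q k).ne')

/-! ### The Hilbert space `L²(SU_q(2))` -/

theorem inner_eta (q : Par) (x y : CSU q) :
    inner ℂ (eta q x) (eta q y) = haar q (star x * y) :=
  UniformSpace.Completion.inner_coe _ _

theorem eta_eq_zero (q : Par) {x : CSU q} (h : eta q x = 0) : x = 0 := by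
  have h1 : haar q (star x * x) = 0 := by rw [← inner_eta, h, inner_zero_left]
  exact CStarRing.star_mul_self_eq_zero_iff x |>.1 (haar_faithful q (star_mul_self_nonneg x) h1)

theorem eta_one_ne_zero (q : Par) : eta q 1 ≠ 0 := by
  intro h
  have h1 := inner_eta q 1 1
  rw [h, inner_zero_left, star_one, one_mul, (isHaar_haar q).1] at h1
  exact zero_ne_one h1

theorem denseRange_eta (q : Par) : DenseRange fun x : ASU q => eta q (toCSU q x) := by
  have hc : Continuous (eta q) := by
    obtain ⟨C, hC⟩ := PositiveLinearMap.exists_norm_apply_le (haar q)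
    refine AddMonoidHomClass.continuous_of_bound (eta q) (√C) fun x => ?_
    refine (sq_le_sq₀ (norm_nonneg _) (by positivity)).1 ?_
    have h : (‖eta q x‖ : ℂ) ^ 2 = haar q (star x * x) := by
      rw [← inner_eta]; exact (inner_self_eq_norm_sq_to_K (𝕜 := ℂ) (eta q x)).symm
    have h1 := hC (star x * x)
    rw [← h, norm_pow, Complex.norm_real, norm_norm, CStarRing.norm_star_mul_self] at h1
    rw [mul_pow, Real.sq_sqrt C.coe_nonneg, sq ‖x‖]
    exact h1
  have hd : DenseRange (eta q) :=
    UniformSpace.Completion.denseRange_coe.comp (haar q).toPreGNS.surjective.denseRange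
      (UniformSpace.Completion.continuous_coe _)
  exact hd.comp (denseRange_toCSU q) hc

theorem ket_eq (q : Par) (i : Lab) :
    ∃ z : ℂ, z ≠ 0 ∧ ket q i = z • eta q (toCSU q (matEl q i)) := by
  refine ⟨_, mul_ne_zero (qpow_ne_zero q _) (Complex.ofReal_ne_zero.2 (Real.sqrt_pos.2
    (qnum_pos q ?_)).ne'), rfl⟩
  rw [Lab.l]; positivity

/-- Only the vanishing of coefficients is used below, so normalization constants can be discarded.
-/
theorem coeff_eq_zero_iff (q : Par) (i : Lab) (ψ : L2 q) :
    coeff q ψ i = 0 ↔ inner ℂ (eta q (toCSU q (matEl q i))) ψ = 0 := by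
  obtain ⟨z, hz, h⟩ := ket_eq q i
  change inner ℂ (ket q i) ψ = 0 ↔ _
  rw [h, inner_smul_left, mul_eq_zero, or_iff_right ((map_ne_zero _).2 hz)]

theorem coeff_eta_eq_zero_iff (q : Par) (i : Lab) (x : CSU q) :
    coeff q (eta q x) i = 0 ↔ haar q (star (toCSU q (matEl q i)) * x) = 0 := by
  rw [coeff_eq_zero_iff, inner_eta]

/-- The vectors `|lmn⟩` are total. -/
theorem eq_zero_of_coeff_eq_zero (q : Par) {ψ : L2 q} (h : ∀ i, coeff q ψ i = 0) : ψ = 0 := by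
  have h1 : ∀ x : ASU q, inner ℂ (eta q (toCSU q x)) ψ = 0 := by
    intro x
    have hx : x ∈ Submodule.span ℂ (Set.range (matEl q)) := span_matEl q ▸ Submodule.mem_top
    induction hx using Submodule.span_induction with
    | mem x hx => obtain ⟨i, rfl⟩ := hx; exact (coeff_eq_zero_iff q i ψ).1 (h i)
    | zero => simp
    | add x y _ _ hx hy => rw [map_add, map_add, inner_add_left, hx, hy, add_zero]
    | smul z x _ hx => rw [map_smul, map_smul, inner_smul_left, hx, mul_zero]
  have h2 := congrFun ((denseRange_eta q).equalizer (g := fun φ : L2 q => inner ℂ φ ψ)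
    (h := fun _ => (0 : ℂ)) (by fun_prop) continuous_const (funext h1)) ψ
  exact inner_self_eq_zero.1 h2

theorem coeff_eta_one (q : Par) {i : Lab} (hi : 0 < i.1) : coeff q (eta q 1) i = 0 := by
  rw [coeff_eta_eq_zero_iff, mul_one, map_star, (isHaar_haar q).2 i, star_zero]
  rw [Lab.l]; positivity

theorem matEl_zero (q : Par) {i : Lab} (hi : i.1 = 0) : ∃ z : ℂ, matEl q i = z • 1 := by
  obtain ⟨d, j, k⟩ := i
  obtain rfl : d = 0 := hi
  obtain ⟨z, -, h⟩ := matEl_eq q ⟨0, j, k⟩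
  have hj : (j : ℕ) = 0 := by omega
  have hk : (k : ℕ) = 0 := by omega
  simp only [hj, hk, pow_zero, mul_one, Module.End.one_apply, Nat.sub_zero] at h
  exact ⟨z, h⟩

/-- The condition 0 < l + n means n > -l. The coefficient at such a label is recovered from σ(F)ψ
one step lower, where the factor is the square root of a product of positive q-numbers. -/
theorem sigmaF_eq_zero_iff (q : Par) (ψ : L2 q) : sigmaF q ψ = 0 ↔
    ∀ i : Lab, 0 < (i.2.2 : ℕ) → coeff q ψ i = 0 := by
  constructor
  · rintro h ⟨d, j, ⟨k, hk⟩⟩ hi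
    obtain ⟨k, rfl⟩ : ∃ l, k = l + 1 := ⟨k - 1, by simp only at hi; omega⟩
    have h1 := congrFun h ⟨d, j, ⟨k, by omega⟩⟩
    change (if h : k + 1 < d + 1 then _ else _) = _ at h1
    rw [dif_pos hk] at h1
    refine (mul_eq_zero.1 h1).resolve_left (Complex.ofReal_ne_zero.2 (Real.sqrt_pos.2
      (mul_pos (qnum_pos q ?_) (qnum_pos q ?_))).ne')
    · simp only [Lab.l, Lab.n]
      have : (k : ℝ) + 1 ≤ d := by exact_mod_cast Nat.lt_succ_iff.1 hk
      linarith
    · simp only [Lab.l, Lab.n]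
      have : (0 : ℝ) ≤ k := by positivity
      linarith
  · intro h
    ext i
    change (if h : (i.2.2 : ℕ) + 1 < i.1 + 1 then _ else _) = (0 : ℂ)
    split_ifs with hi
    · rw [h _ (Nat.succ_pos _), mul_zero]
    · rfl

theorem mem_L2CP_iff (q : Par) (ψ : L2 q) : ψ ∈ L2CP q ↔
    ∀ i : Lab, (i.1 : ℤ) - 2 * (i.2.2 : ℕ) ≠ 0 → coeff q ψ i = 0 := by
  simp only [L2CP, Submodule.mem_iInf, LinearMap.mem_eqLocus]
  constructor
  · intro h i hi
    obtain ⟨u, hu⟩ := exists_circle_zpow_ne_one hi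
    have h1 : ((u ^ ((i.1 : ℤ) - 2 * (i.2.2 : ℕ)) : Circle) : ℂ) * coeff q ψ i = coeff q ψ i :=
      congrFun (h u) i
    refine (mul_left_eq_self₀.1 h1).resolve_left fun h2 => hu ?_
    exact Circle.ext (h2.trans Circle.coe_one.symm)
  · intro h u
    ext i
    change ((u ^ ((i.1 : ℤ) - 2 * (i.2.2 : ℕ)) : Circle) : ℂ) * coeff q ψ i = coeff q ψ i
    by_cases hi : (i.1 : ℤ) - 2 * (i.2.2 : ℕ) = 0
    · rw [hi, zpow_zero, Circle.coe_one, one_mul]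
    · rw [h i hi, mul_zero]

theorem sigmaF_eta_one (q : Par) : sigmaF q (eta q 1) = 0 :=
  (sigmaF_eq_zero_iff q _).2 fun i hi => coeff_eta_one q (by have := i.2.2.2; omega)

theorem kerSigmaF_eq (q : Par) : kerSigmaF q = Submodule.span ℂ {eta q 1} := by
  refine le_antisymm ?_ ?_
  · rintro ψ ⟨⟨h1, -⟩, h2⟩
    have h1 := (mem_L2CP_iff q ψ).1 h1
    have h2 := (sigmaF_eq_zero_iff q ψ).1 h2
    -- Labels with n > -l are killed by σ(F). A label with n = -l and l > 0 has n ≠ 0 and is killed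
    -- by invariance.
    have h3 : ∀ i : Lab, 0 < i.1 → coeff q ψ i = 0 := by
      intro i hi
      by_cases h : 0 < (i.2.2 : ℕ)
      · exact h2 i h
      · exact h1 i (by omega)
    rw [Submodule.mem_span_singleton]
    refine ⟨inner ℂ (eta q 1) ψ, ?_⟩
    rw [eq_comm, ← sub_eq_zero]
    refine eq_zero_of_coeff_eq_zero q fun i => ?_
    rcases Nat.eq_zero_or_pos i.1 with hi | hi
    · obtain ⟨z, hz⟩ := matEl_zero q hi
      rw [coeff_eq_zero_iff, hz, map_smul, map_one, map_smul, inner_smul_left, inner_sub_right,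
        inner_smul_right, inner_eta, star_one, one_mul, (isHaar_haar q).1, mul_one, sub_self,
        mul_zero]
    · rw [map_sub, map_smul, Pi.sub_apply, Pi.smul_apply, h3 i hi, coeff_eta_one q hi, smul_zero,
        sub_zero]
  · rw [Submodule.span_singleton_le_iff_mem]
    -- The vector 0 has the coefficients of σ(F)η(1), so η(1) is in the domain.
    refine ⟨⟨(mem_L2CP_iff q _).2 fun i hi => ?_, 0, ?_⟩, sigmaF_eta_one q⟩
    · refine coeff_eta_one q (Nat.pos_of_ne_zero fun h => hi ?_)
      have := i.2.2.2
      omega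
    · rw [map_zero, sigmaF_eta_one]

/-! ### Holomorphic elements -/

theorem haar_mapC_tau (q : Par) (g : Circle × Circle) (x : CSU q) :
    haar q (mapC (tau q g) x) = haar q x := by
  refine congrFun ((denseRange_toCSU q).equalizer ((continuous_positive _).comp
    (continuous_mapC _)) (continuous_positive _) (funext fun y => ?_)) x
  change haar q (toCSU q (tau q g y)) = haar q (toCSU q y)
  rw [haar_eq, haarSum_tau]

/-- The monomial a^{l-m} c^{l+m} has weight u^{2l}, and each of the l + n applications of E
contributes u^{-2}. -/
theorem alpha_matEl (q : Par) (u : Circle) (i : Lab) : alpha q u (matEl q i) =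
    ((u ^ ((i.1 : ℤ) - 2 * (i.2.2 : ℕ)) : Circle) : ℂ) • matEl q i := by
  obtain ⟨z, -, h⟩ := matEl_eq q i
  obtain ⟨d, j, k⟩ := i
  have h1 := tau_nmon q (u, u) ((d - (j : ℕ) : ℕ) : ℤ) j 0
  rw [nmon, apow_natCast, pow_zero, mul_one] at h1
  have h2 := actE_pow_tau q (u, u) k (ga q ^ (d - (j : ℕ)) * gc q ^ (j : ℕ))
  rw [h1, map_smul] at h2
  simp only at h h2 ⊢
  rw [h, map_smul, alpha_eq_tau, smul_comm]
  congr 1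
  have h3 : ((u * u : Circle) : ℂ) ^ (k : ℕ) ≠ 0 := pow_ne_zero _ (Circle.coe_ne_zero _)
  rw [← inv_smul_smul₀ h3 (tau q (u, u) _), ← h2, smul_smul]
  congr 1
  rw [inv_mul_eq_iff_eq_mul₀ h3, ← Circle.coe_pow, ← Circle.coe_mul]
  congr 1
  rw [← zpow_natCast, mul_zpow, ← zpow_add, ← zpow_add, ← zpow_add]
  congr 1
  have := j.2
  omega

/-- Since h is invariant and f is fixed, h(t* f) equals itself times the conjugate weight of t, so
it vanishes when that weight is nontrivial. -/
theorem eta_mem_L2CP (q : Par) {f : CSU q} (hf : f ∈ CCP q) : eta q f ∈ L2CP q := by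
  rw [mem_L2CP_iff]
  intro i hi
  rw [coeff_eta_eq_zero_iff]
  obtain ⟨u, hu⟩ := exists_circle_zpow_ne_one hi
  have h1 := haar_mapC_tau q (u, u) (star (toCSU q (matEl q i)) * f)
  rw [map_mul, map_star, mapC_toCSU, ← alpha_eq_tau, ← alphaC_eq, hf u, alpha_matEl, map_smul,
    star_smul, smul_mul_assoc, map_smul] at h1
  refine (mul_left_eq_self₀.1 h1).resolve_left fun h2 => hu ?_
  rw [star_eq_iff_star_eq, star_one] at h2
  exact Circle.ext (h2.symm.trans Circle.coe_one.symm)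

theorem holoCont_eq (q : Par) : holoCont q = Set.range (algebraMap ℂ (CSU q)) := by
  have h0 : ∀ f : CSU q, ActFC q f 0 ↔ sigmaF q (eta q f) = 0 := by
    intro f; rw [ActFC, map_zero, map_zero]
  ext f
  constructor
  · rintro ⟨-, h1, h2⟩
    rw [h0] at h2
    have h3 : eta q f ∈ kerSigmaF q := ⟨⟨eta_mem_L2CP q h1, 0, by rw [map_zero, h2]⟩, h2⟩
    rw [kerSigmaF_eq, Submodule.mem_span_singleton] at h3
    obtain ⟨z, hz⟩ := h3
    refine ⟨z, (sub_eq_zero.1 (eta_eq_zero q ?_)).symm⟩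
    rw [map_sub, Algebra.algebraMap_eq_smul_one, map_smul, hz, sub_self]
  · rintro ⟨z, rfl⟩
    have h1 : ActFC q (algebraMap ℂ (CSU q) z) 0 := by
      rw [h0, Algebra.algebraMap_eq_smul_one, map_smul, map_smul, sigmaF_eta_one, smul_zero]
    exact ⟨⟨0, h1⟩, (CCP q).algebraMap_mem z, h1⟩

theorem holoPoly_eq (q : Par) : holoPoly q = ⊥ := by
  refine eq_bot_iff.2 fun f hf => ?_
  have hf' : actF q (actKe q 1 f) = 0 := (dbar_eq_zero_iff q f).1 hf
  -- One K comes from X_- = q^{-1/2} F K, the other from the Leibniz rule: F ▷ (x* (K ▷ f)) = (F ▷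
  -- x*) w, since F ▷ (K ▷ f) = 0. Applying h gives `horth`.
  set w : ASU q := actKe q 1 (actKe q 1 f) with hw
  have horth : ∀ x : ASU q, haar q (toCSU q (star (actE q x) * w)) = 0 := by
    intro x
    have h := haar_actF q (star x * actKe q 1 f)
    rw [actF_mul, hf', mul_zero, add_zero] at h
    rw [star_actE, smul_mul_assoc, map_smul, map_smul, h, smul_zero]
  have hhol : toCSU q w ∈ holoCont q := by
    have h1 : ActFC q (toCSU q w) 0 := by
      rw [ActFC, map_zero, map_zero, sigmaF_eq_zero_iff]
      intro i hi
      obtain ⟨z, -, h⟩ := matEl_eq q i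
      obtain ⟨k, hk⟩ : ∃ l, (i.2.2 : ℕ) = l + 1 := ⟨(i.2.2 : ℕ) - 1, by omega⟩
      rw [coeff_eta_eq_zero_iff, ← map_star, ← map_mul, h, hk, pow_succ', Module.End.mul_apply,
        star_smul, smul_mul_assoc, map_smul, map_smul, horth, smul_zero]
    refine ⟨⟨0, h1⟩, fun u => ?_, h1⟩
    -- K commutes with the torus action, so w inherits the U(1)-invariance of f.
    rw [alphaC_toCSU, hw, alpha_eq_tau, ← actKe_tau, ← actKe_tau, ← alpha_eq_tau, f.2 u]
  rw [holoCont_eq] at hhol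
  obtain ⟨z, hz⟩ := hhol
  have h1 : w = algebraMap ℂ _ z :=
    toCSU_injective q (by rw [← hz, AlgHomClass.commutes])
  have hK : ∀ x : ASU q, actKe q (-1) (actKe q 1 x) = x := fun x => by
    simpa using actKe_neg q (-1) x
  refine Algebra.mem_bot.2 ⟨z, Subtype.ext ?_⟩
  change algebraMap ℂ (ASU q) z = f
  rw [← hK f, ← hK (actKe q 1 f), ← hw, h1, AlgHom.commutes, AlgHom.commutes]

end QuantumCP
end

theorem mainTheorem5 (q : QuantumCP.Par) :
    -- the kernel of `σ(F)` on `L²(CP^1_q)` is `ℂ`, spanned by `η(1) = |000⟩`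
    (QuantumCP.kerSigmaF q = Submodule.span ℂ {QuantumCP.eta q 1} ∧ QuantumCP.eta q 1 ≠ 0) ∧
    -- holomorphic polynomial functions are constant
    (QuantumCP.holoPoly q = ⊥ ∧ Nonempty (QuantumCP.holoPoly q ≃ₐ[ℂ] ℂ)) ∧
    -- holomorphic continuous functions are constant
    (QuantumCP.holoCont q = Set.range (algebraMap ℂ (QuantumCP.CSU q)) ∧
      ∃ O : Subalgebra ℂ (QuantumCP.CSU q),
        (O : Set (QuantumCP.CSU q)) = QuantumCP.holoCont q ∧ Nonempty (O ≃ₐ[ℂ] ℂ)) := by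
  -- Identifying the scalars with ℂ needs both algebras to be nonzero. This follows from η(1) ≠ 0,
  -- and for A(CP^1_q) by mapping 1 into C(SU_q(2)).
  have hC : Nontrivial (QuantumCP.CSU q) :=
    ⟨1, 0, fun h => QuantumCP.eta_one_ne_zero q (by rw [h, map_zero])⟩
  have hA : Nontrivial (QuantumCP.ACP q) := by
    refine ⟨1, 0, fun h => one_ne_zero (α := QuantumCP.CSU q) ?_⟩
    rw [← map_one (QuantumCP.toCSU q), ← OneMemClass.coe_one (QuantumCP.ACP q), h,
      ZeroMemClass.coe_zero, map_zero]
  refine ⟨⟨QuantumCP.kerSigmaF_eq q, QuantumCP.eta_one_ne_zero q⟩,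
    ⟨QuantumCP.holoPoly_eq q, ?_⟩, QuantumCP.holoCont_eq q, ⊥, ?_,
    ⟨Algebra.botEquiv ℂ (QuantumCP.CSU q)⟩⟩
  · rw [QuantumCP.holoPoly_eq]
    exact ⟨Algebra.botEquiv ℂ (QuantumCP.ACP q)⟩
  · rw [QuantumCP.holoCont_eq, Algebra.coe_bot]
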